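/- All graphs are finite, simple and undirected. Let $G$ be a unicyclic graph, i.e. a connected graph with exactly one cycle $\mathcal C$, let $\ell\ge 3$ be the length of $\mathcal C$, and write $d_G$ for distance and $\deg$ for degree in $G$. **Definitions.** For $v\in V(\mathcal C)$ let $T_v$ be the component containing $v$ of the graph obtained from $G$ by deleting the edges of $\mathcal C$. For $S\subseteq V(G)$, a vertex $v\in V(\mathcal C)$ is *$S$-active* if $T_v$ contains a vertex of $S$; $\mathcal A(S)$ is the set of $S$-active vertices. A vertex $v$ is *branching* if $v\in V(\mathcal C)$ and $\deg(v)\ge 4$, or $v\notin V(\mathcal C)$ and $\deg(v)\ge 3$. A *thread* attached to a vertex $v$ with $\deg(v)\ge 3$ is a path $v_1\dots v_k$ $(k\ge 1)$ with $v_1$ adjacent to $v$, $\deg(v_i)=2$ for $i<k$ and $\deg(v_k)=1$. A vertex $v\in V(\mathcal C)$ with $\deg(v)\ge 4$ is *bad* if some thread is attached to it. A set $S\subseteq V(G)$ is *branch-resolving* if for every $v$ with $\deg(v)\ge 3$ all threads attached to $v$, except at most one, contain a vertex of $S$. Let $\mathcal B(G)$ be the set of branch-resolving sets of minimum cardinality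 all of whose elements have degree $1$. A set $S\subseteq V(G)$ is a *metric generator* if for any two distinct vertices $u,u'$ of $G$ there is $v\in S$ with $d_G(v,u)\ne d_G(v,u')$. Three distinct vertices $u,v,w$ of $\mathcal C$ form a *geodesic triple* if $d_G(u,v)+d_G(v,w)+d_G(w,u)=\ell$. A labeling $\mathcal C=a_0a_1\dots a_{\ell-1}a_0$ is *normal* with respect to $S$ if $a_0$ is $S$-active and the largest index of an $S$-active vertex is minimum among all labelings of $\mathcal C$ in which the vertex with index $0$ is $S$-active. For a labeling $\mathcal C=a_0a_1\dots a_{\ell-1}a_0$ and $1\le j\le\lfloor\frac{\ell-1}{2}\rfloor$ consider the conditions: (i) neither $a_0$ nor $a_j$ is bad; (ii) if $j<\lfloor\frac{\ell-2}{2}\rfloor$, then $V(T_{a_k})=\{a_k\}$ for every $k\in\{\ell-1,\dots,\ell-(\lfloor\frac{\ell-2}{2}\rfloor-j)\}\cup\{j+1,\dots,j+(\lfloor\frac{\ell-2}{2}\rfloor-j)\}$; (iii) if $j>1$ and $T_{a_k}$ contains no branching vertex for every $k\in[1,j-1]$ (so that each of these $T_{a_k}$ is a path), then for every $k\in[1,j-1]$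 the length of $T_{a_k}$ is at most $\frac{\ell-2}{2}-j$. With respect to the labeling, $G$ is an *odd-$(\ell,j)$ graph* if $1\le j\le\lfloor\frac{\ell-1}{2}\rfloor$, $\ell$ is odd, and either $j=\lfloor\frac{\ell-1}{2}\rfloor$ or (i) and (ii) hold; $G$ is an *even-$(\ell,j)$ graph* if $1\le j\le\lfloor\frac{\ell-1}{2}\rfloor$, $\ell$ is even, and (i), (ii) and (iii) hold. **Theorem.** Let $G$ be a unicyclic graph and let $S\in\mathcal B(G)$ with $|\mathcal A(S)|\ge 2$. Let $\mathcal C=a_0a_1\dots a_{\ell-1}a_0$ be a normal labeling with respect to $S$, and let $j=\max\{i : a_i\in\mathcal A(S)\}$. Then $S$ is a metric generator of $G$ if and only if there are three $S$-active vertices forming a geodesic triple, or $G$ is an odd-$(\ell,j)$ graph or an even-$(\ell,j)$ graph with respect to this labeling. -/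

import Mathlib

namespace UnicyclicMetric

/-- A subgraph of `G` that is a cycle. -/
def IsCycleSubgraph {V : Type*} {G : SimpleGraph V} (C : G.Subgraph) : Prop :=
  ∃ (v : V) (p : G.Walk v v), p.IsCycle ∧ p.toSubgraph = C

/-- A unicyclic graph: connected, with exactly one cycle. -/
def IsUnicyclic {V : Type*} (G : SimpleGraph V) : Prop :=
  G.Connected ∧ ∃! C : G.Subgraph, IsCycleSubgraph C

/-- `a 0, a 1, …, a (ℓ - 1), a 0` is a cycle of length `ℓ` of `G`
(in a unicyclic graph: a labeling of the vertices of its only cycle). -/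
structure IsCycleLabeling {V : Type*} (G : SimpleGraph V) {ℓ : ℕ} (a : ZMod ℓ → V) : Prop where
  three_le : 3 ≤ ℓ
  injective : Function.Injective a
  adj : ∀ i, G.Adj (a i) (a (i + 1))

/-- The edges of the labeled cycle. -/
def cycleEdges {V : Type*} {ℓ : ℕ} (a : ZMod ℓ → V) : Set (Sym2 V) :=
  Set.range fun i => s(a i, a (i + 1))

/-- The vertex set of `T_v`, the component containing `v` of the graph obtained from `G` by
deleting the edges of the labeled cycle. -/
def tree {V : Type*} (G : SimpleGraph V) {ℓ : ℕ} (a : ZMod ℓ → V) (v : V) : Set V :=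
  {x | (G.deleteEdges (cycleEdges a)).Reachable v x}

/-- The set of `S`-active vertices: the cycle vertices `v` such that `T_v` meets `S`. -/
def activeVertices {V : Type*} (G : SimpleGraph V) {ℓ : ℕ} (a : ZMod ℓ → V) (S : Finset V) :
    Set V :=
  {v | v ∈ Set.range a ∧ ∃ x ∈ S, x ∈ tree G a v}

/-- The indices `i ∈ [0, ℓ - 1]` for which `a_i` is `S`-active. -/
def activeIndices {V : Type*} (G : SimpleGraph V) {ℓ : ℕ} (a : ZMod ℓ → V) (S : Finset V) :
    Set ℕ :=
  {i | i < ℓ ∧ a (i : ZMod ℓ) ∈ activeVertices G a S}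

/-- A normal labeling of the cycle with respect to `S`: `a_0` is `S`-active, and the largest index
of an `S`-active vertex is as small as possible among all labelings of the cycle for which the
vertex with index `0` is `S`-active. -/
def IsNormalLabeling {V : Type*} (G : SimpleGraph V) {ℓ : ℕ} (a : ZMod ℓ → V) (S : Finset V) :
    Prop :=
  IsCycleLabeling G a ∧ a 0 ∈ activeVertices G a S ∧
    ∀ b : ZMod ℓ → V, IsCycleLabeling G b → b 0 ∈ activeVertices G b S →
      ∀ i j : ℕ, IsGreatest (activeIndices G a S) i → IsGreatest (activeIndices G b S) j → i ≤ j

/-- `S` is a metric generator: any two distinct vertices are distinguished by an element of `S`. -/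
def IsMetricGenerator {V : Type*} (G : SimpleGraph V) (S : Finset V) : Prop :=
  ∀ u u' : V, u ≠ u' → ∃ v ∈ S, G.dist v u ≠ G.dist v u'

/-- The threads attached to `v`: the paths `v_1 … v_k`, `k ≥ 1`, with `v_1` adjacent to `v`,
with `v_1, …, v_{k-1}` of degree `2` and with `v_k` of degree `1`. -/
def threads {V : Type*} [Fintype V] (G : SimpleGraph V) [DecidableRel G.Adj] (v : V) :
    Set (List V) :=
  {p | p.Nodup ∧ (v :: p).IsChain G.Adj ∧ (∀ x ∈ p.dropLast, G.degree x = 2) ∧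
    ∃ x ∈ p.getLast?, G.degree x = 1}

/-- `S` is a branch-resolving set: for every vertex `v` of degree at least `3`, all threads
attached to `v`, except at most one, contain a vertex of `S`. -/
def IsBranchResolving {V : Type*} [Fintype V] (G : SimpleGraph V) [DecidableRel G.Adj]
    (S : Finset V) : Prop :=
  ∀ v : V, 3 ≤ G.degree v →
    (threads G v).ncard ≤ {p | p ∈ threads G v ∧ ∃ x ∈ p, x ∈ S}.ncard + 1

/-- `S` is a branch-resolving set of minimum cardinality, all of whose elements have degree `1`. -/
def IsMinLeafBranchResolving {V : Type*} [Fintype V] (G : SimpleGraph V) [DecidableRel G.Adj]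
    (S : Finset V) : Prop :=
  IsBranchResolving G S ∧ (∀ S' : Finset V, IsBranchResolving G S' → S.card ≤ S'.card) ∧
    ∀ x ∈ S, G.degree x = 1

/-- Branching vertices: cycle vertices of degree at least `4`, other vertices of degree at
least `3`. -/
def IsBranching {V : Type*} [Fintype V] (G : SimpleGraph V) [DecidableRel G.Adj] {ℓ : ℕ}
    (a : ZMod ℓ → V) (v : V) : Prop :=
  (v ∈ Set.range a ∧ 4 ≤ G.degree v) ∨ (v ∉ Set.range a ∧ 3 ≤ G.degree v)

/-- Bad vertices: cycle vertices of degree at least `4` to which a thread is attached. -/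
def IsBad {V : Type*} [Fintype V] (G : SimpleGraph V) [DecidableRel G.Adj] {ℓ : ℕ}
    (a : ZMod ℓ → V) (v : V) : Prop :=
  v ∈ Set.range a ∧ 4 ≤ G.degree v ∧ (threads G v).Nonempty

/-- Three vertices of the cycle form a geodesic triple. -/
def IsGeodesicTriple {V : Type*} (G : SimpleGraph V) {ℓ : ℕ} (a : ZMod ℓ → V) (u v w : V) :
    Prop :=
  (u ∈ Set.range a ∧ v ∈ Set.range a ∧ w ∈ Set.range a) ∧ (u ≠ v ∧ v ≠ w ∧ w ≠ u) ∧
    G.dist u v + G.dist v w + G.dist w u = ℓ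

/-- Condition (i): neither `a_0` nor `a_j` is bad. -/
def CondI {V : Type*} [Fintype V] (G : SimpleGraph V) [DecidableRel G.Adj] {ℓ : ℕ}
    (a : ZMod ℓ → V) (j : ℕ) : Prop :=
  ¬ IsBad G a (a 0) ∧ ¬ IsBad G a (a (j : ZMod ℓ))

/-- Condition (ii): if `j < ⌊(ℓ - 2) / 2⌋`, then `T_{a_k}` is trivial for all `k` in
`{ℓ - 1, …, ℓ - (⌊(ℓ - 2) / 2⌋ - j)} ∪ {j + 1, …, j + (⌊(ℓ - 2) / 2⌋ - j)}`. -/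
def CondII {V : Type*} (G : SimpleGraph V) {ℓ : ℕ} (a : ZMod ℓ → V) (j : ℕ) : Prop :=
  j < (ℓ - 2) / 2 →
    ∀ k ∈ Set.Icc (ℓ - ((ℓ - 2) / 2 - j)) (ℓ - 1) ∪ Set.Icc (j + 1) (j + ((ℓ - 2) / 2 - j)),
      tree G a (a (k : ZMod ℓ)) = {a (k : ZMod ℓ)}

/-- Condition (iii): if `j > 1` and no `T_{a_k}` with `k ∈ [1, j - 1]` contains a branching vertex
(so that each of these `T_{a_k}` is a path), then each of these paths has length at most
`(ℓ - 2) / 2 - j`; the length of a path is its number of vertices minus one. -/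
def CondIII {V : Type*} [Fintype V] (G : SimpleGraph V) [DecidableRel G.Adj] {ℓ : ℕ}
    (a : ZMod ℓ → V) (j : ℕ) : Prop :=
  1 < j → (∀ k ∈ Set.Icc 1 (j - 1), ∀ x ∈ tree G a (a (k : ZMod ℓ)), ¬ IsBranching G a x) →
    ∀ k ∈ Set.Icc 1 (j - 1), (tree G a (a (k : ZMod ℓ))).ncard - 1 ≤ (ℓ - 2) / 2 - j

/-- `G`, with its cycle labeled by `a`, is an odd-`(ℓ, j)` graph. -/
def IsOddGraph {V : Type*} [Fintype V] (G : SimpleGraph V) [DecidableRel G.Adj] {ℓ : ℕ}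
    (a : ZMod ℓ → V) (j : ℕ) : Prop :=
  Odd ℓ ∧ j ∈ Set.Icc 1 ((ℓ - 1) / 2) ∧ (j = (ℓ - 1) / 2 ∨ (CondI G a j ∧ CondII G a j))

/-- `G`, with its cycle labeled by `a`, is an even-`(ℓ, j)` graph. -/
def IsEvenGraph {V : Type*} [Fintype V] (G : SimpleGraph V) [DecidableRel G.Adj] {ℓ : ℕ}
    (a : ZMod ℓ → V) (j : ℕ) : Prop :=
  Even ℓ ∧ j ∈ Set.Icc 1 ((ℓ - 1) / 2) ∧ CondI G a j ∧ CondII G a j ∧ CondIII G a j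

end UnicyclicMetric

/-! Deleting the edges of the cycle leaves a forest with exactly one cycle vertex in each component.
So every vertex has a height above the cycle and a position on it, and two vertices of different
trees are at distance height + cyclic distance + height (`Rooting.dist_of_idx_ne`). Distinct
vertices of one tree are always distinguished: an element of `S` in another tree compares their
heights, and at equal heights `S` meets one of the two branches through which their paths to the
cycle merge (`eq_of_idx_eq`).

If `u`, `u'` in different trees are not distinguished, then every `s ∈ S` acts on them like its foot
on the cycle, even when it shares a tree with one of them (`height_add_cyc_eq`). What remains is
arithmetic: which pairs of positions, with the heights as offsets, do the active positions fail to
separate? A geodesic triple separates all of them (`eq_of_cyc`). Without such a triple, normality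
forces `2j ≤ ℓ`, and `2j = ℓ` is impossible for a generator.

For `2j < ℓ`, the positions `0` and `j` can confuse only two positions in `[j, ℓ/2]`, two positions
in the mirror arc that ends at `0`, or, for even `ℓ`, a position `i` strictly between `0` and `j`
with `ℓ/2 + j - i` (`cyc_cases`). On the arc after `j`, the vertex at the smaller position has
positive height; it lies in a tree that (ii) makes trivial, or in an `S`-free branch at `a_j`, which
makes `a_j` bad. An opposite pair needs height at least `ℓ/2 - j` in a tree strictly between `0` and
`j`, and no active position there, against (iii). Conversely, each violated condition yields a
confused pair; for (i), the minimality of `S` provides an `S`-free thread at a bad vertex. -/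

namespace UnicyclicMetric

open SimpleGraph

/-! ### The cycle and the forest left by deleting its edges -/

section Labeling

variable {V : Type*} {G : SimpleGraph V} {ℓ : ℕ} {a : ZMod ℓ → V}

lemma IsCycleLabeling.neZero (ha : IsCycleLabeling G a) : NeZero ℓ :=
  ⟨by have := ha.three_le; omega⟩

lemma IsCycleLabeling.natCast_inj (ha : IsCycleLabeling G a) {m n : ℕ} (hm : m < ℓ) (hn : n < ℓ)
    (h : a (m : ZMod ℓ) = a (n : ZMod ℓ)) : m = n := by
  have h' := congrArg ZMod.val (ha.injective h)
  rwa [ZMod.val_cast_of_lt hm, ZMod.val_cast_of_lt hn] at h'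

lemma IsCycleLabeling.exists_path (ha : IsCycleLabeling G a) (n : ℕ) (hn : n < ℓ) :
    ∃ p : G.Walk (a 0) (a (n : ZMod ℓ)), p.IsPath ∧
      (∀ x ∈ p.support, ∃ k ≤ n, x = a (k : ZMod ℓ)) ∧
      (∀ e ∈ p.edges, ∃ k < n, e = s(a (k : ZMod ℓ), a ((k + 1 : ℕ) : ZMod ℓ))) := by
  induction n with
  | zero =>
    refine ⟨Walk.nil.copy rfl (by simp), by simp, ?_, by simp⟩
    intro x hx
    exact ⟨0, le_rfl, by simpa using hx⟩
  | succ n ih =>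
    obtain ⟨p, hp, hs, he⟩ := ih (by omega)
    have hadj : G.Adj (a (n : ZMod ℓ)) (a ((n + 1 : ℕ) : ZMod ℓ)) := by
      simpa using ha.adj (n : ZMod ℓ)
    refine ⟨p.concat hadj, hp.concat ?_ hadj, ?_, ?_⟩
    · intro h
      obtain ⟨k, hk, e⟩ := hs _ h
      have := ha.natCast_inj hn (by omega) e
      omega
    · intro x hx
      rw [Walk.support_concat, List.mem_append, List.mem_singleton] at hx
      rcases hx with hx | rfl
      · obtain ⟨k, hk, e⟩ := hs x hx
        exact ⟨k, by omega, e⟩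
      · exact ⟨n + 1, le_rfl, rfl⟩
    · intro e hx
      rw [Walk.edges_concat, List.concat_eq_append, List.mem_append, List.mem_singleton] at hx
      rcases hx with hx | rfl
      · obtain ⟨k, hk, e⟩ := he e hx
        exact ⟨k, by omega, e⟩
      · exact ⟨n, by omega, rfl⟩

/-- A labeled cycle is a cycle all of whose edges are edges of the labeling. -/
lemma IsCycleLabeling.exists_isCycle (ha : IsCycleLabeling G a) :
    ∃ p : G.Walk (a 0) (a 0), p.IsCycle ∧ ∀ e ∈ p.edges, e ∈ cycleEdges a := by
  have h3 := ha.three_le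
  obtain ⟨p, hp, hs, he⟩ := ha.exists_path (ℓ - 1) (by omega)
  have hl : (((ℓ - 1 : ℕ) : ZMod ℓ)) + 1 = 0 := by
    have : ((ℓ - 1 + 1 : ℕ) : ZMod ℓ) = 0 := by
      rw [show ℓ - 1 + 1 = ℓ by omega]; simp
    simpa using this
  have hadj : G.Adj (a ((ℓ - 1 : ℕ) : ZMod ℓ)) (a 0) := by
    have := ha.adj ((ℓ - 1 : ℕ) : ZMod ℓ)
    rwa [hl] at this
  refine ⟨Walk.cons hadj.symm p.reverse, ?_, ?_⟩
  · rw [Walk.cons_isCycle_iff]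
    refine ⟨hp.reverse, ?_⟩
    intro h
    rw [Walk.edges_reverse, List.mem_reverse] at h
    obtain ⟨k, hk, e⟩ := he _ h
    rw [Sym2.eq_iff] at e
    rcases e with ⟨e1, e2⟩ | ⟨e1, e2⟩
    · have h1 := ha.natCast_inj (m := 0) (n := k) (by omega) (by omega) (by simpa using e1)
      have h2 := ha.natCast_inj (by omega) (by omega) e2
      omega
    · have h2 := ha.natCast_inj (by omega) (by omega) e2
      omega
  · intro e h
    rw [Walk.edges_cons, List.mem_cons, Walk.edges_reverse, List.mem_reverse] at h
    rcases h with rfl | h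
    · exact ⟨((ℓ - 1 : ℕ) : ZMod ℓ), by simp only [hl]; exact Sym2.eq_swap⟩
    · obtain ⟨k, hk, rfl⟩ := he _ h
      exact ⟨k, by simp⟩

lemma IsUnicyclic.edges_subset_cycleEdges (hG : IsUnicyclic G) (ha : IsCycleLabeling G a)
    {v : V} {p : G.Walk v v} (hp : p.IsCycle) : ∀ e ∈ p.edges, e ∈ cycleEdges a := by
  obtain ⟨q, hq, hqe⟩ := ha.exists_isCycle
  have h := hG.2.unique ⟨v, p, hp, rfl⟩ ⟨_, q, hq, rfl⟩
  intro e he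
  apply hqe
  rw [← Walk.mem_edges_toSubgraph] at he ⊢
  rwa [← h]

lemma IsUnicyclic.isAcyclic_deleteEdges (hG : IsUnicyclic G) (ha : IsCycleLabeling G a) :
    (G.deleteEdges (cycleEdges a)).IsAcyclic := by
  intro v c hc
  have hc' := hc.mapLe (G.deleteEdges_le (cycleEdges a))
  cases c with
  | nil => exact hc.ne_nil rfl
  | @cons _ w _ h p =>
    have h1 := hG.edges_subset_cycleEdges ha hc' s(v, w) (by simp)
    rw [deleteEdges_adj] at h
    exact h.2 h1

lemma IsUnicyclic.isBridge (hG : IsUnicyclic G) (ha : IsCycleLabeling G a) {x y : V}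
    (h : (G.deleteEdges (cycleEdges a)).Adj x y) : G.IsBridge s(x, y) := by
  rw [deleteEdges_adj] at h
  rw [isBridge_iff_forall_cycle_notMem (by simpa using h.1)]
  intro u p hp hm
  exact h.2 (hG.edges_subset_cycleEdges ha hp _ hm)

lemma IsCycleLabeling.reachable_zero {H : SimpleGraph V} [NeZero ℓ]
    (h : ∀ i, H.Adj (a i) (a (i + 1))) (i : ZMod ℓ) : H.Reachable (a 0) (a i) := by
  have key : ∀ n : ℕ, H.Reachable (a 0) (a (n : ZMod ℓ)) := by
    intro n
    induction n with
    | zero => simp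
    | succ n ih => exact ih.trans (by simpa using (h n).reachable)
  simpa using key i.val

/-- The first edge of an off-cycle path between two cycle vertices would be a bridge, yet its ends
stay connected through the cycle and the rest of the path. -/
lemma IsUnicyclic.eq_of_reachable (hG : IsUnicyclic G) (ha : IsCycleLabeling G a) {i k : ZMod ℓ}
    (h : (G.deleteEdges (cycleEdges a)).Reachable (a i) (a k)) : i = k := by
  have := ha.neZero
  by_contra hne
  obtain ⟨p, hp⟩ := h.exists_isPath
  have hav : a i ≠ a k := fun e => hne (ha.injective e)
  generalize ha1 : a i = x at *
  cases p with
  | nil => exact hav rfl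
  | @cons _ y _ hadj p =>
    have hb := hG.isBridge ha hadj
    rw [isBridge_iff] at hb
    apply hb
    have hcyc : ∀ n, (G.deleteEdges {s(x, y)}).Adj (a n) (a (n + 1)) := by
      intro n
      rw [deleteEdges_adj]
      refine ⟨ha.adj n, ?_⟩
      intro e
      rw [deleteEdges_adj] at hadj
      exact hadj.2 ⟨n, e⟩
    have h1 : (G.deleteEdges {s(x, y)}).Reachable x (a k) := by
      have := (IsCycleLabeling.reachable_zero hcyc i).symm.trans
        (IsCycleLabeling.reachable_zero hcyc k)
      rwa [ha1] at this
    refine h1.trans (Reachable.symm ?_)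
    rw [Walk.cons_isPath_iff] at hp
    refine ⟨p.transfer _ ?_⟩
    intro e he
    rw [edgeSet_deleteEdges]
    refine ⟨?_, ?_⟩
    · have := p.edges_subset_edgeSet he
      rw [edgeSet_deleteEdges] at this
      exact this.1
    · rintro rfl
      exact hp.2 (p.fst_mem_support_of_mem_edges he)

lemma IsUnicyclic.exists_reachable (hG : IsUnicyclic G) (a : ZMod ℓ → V) (x : V) :
    ∃ i, (G.deleteEdges (cycleEdges a)).Reachable (a i) x := by
  have key : ∀ y, G.Walk x y → (∃ i, (G.deleteEdges (cycleEdges a)).Reachable (a i) y) →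
      ∃ i, (G.deleteEdges (cycleEdges a)).Reachable (a i) x := by
    intro y p
    induction p with
    | nil => exact id
    | @cons u v w h p ih =>
      intro hw
      obtain ⟨i, hi⟩ := ih hw
      by_cases he : s(u, v) ∈ cycleEdges a
      · obtain ⟨n, hn⟩ := he
        simp only [Sym2.eq_iff] at hn
        rcases hn with ⟨rfl, -⟩ | ⟨-, rfl⟩
        · exact ⟨n, Reachable.rfl⟩
        · exact ⟨n + 1, Reachable.rfl⟩
      · refine ⟨i, hi.trans ?_⟩
        apply Reachable.symm
        apply SimpleGraph.Adj.reachable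
        rw [deleteEdges_adj]
        exact ⟨h, he⟩
  obtain ⟨p⟩ := hG.1.preconnected x (a 0)
  exact key _ p ⟨0, Reachable.rfl⟩

end Labeling

/-- A description of `G` as trees rooted at the vertices of a labeled cycle. -/
structure Rooting {V : Type*} (G : SimpleGraph V) {ℓ : ℕ} (a : ZMod ℓ → V) where
  /-- the distance to the cycle -/
  height : V → ℕ
  /-- the neighbor closer to the cycle -/
  parent : V → V
  /-- the label of the closest cycle vertex -/
  foot : V → ZMod ℓ
  height_label : ∀ i, height (a i) = 0
  foot_label : ∀ i, foot (a i) = i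
  eq_of_height : ∀ x, height x = 0 → x = a (foot x)
  adj_parent : ∀ x, height x ≠ 0 → G.Adj x (parent x)
  height_parent : ∀ x, height x ≠ 0 → height x = height (parent x) + 1
  foot_parent : ∀ x, height x ≠ 0 → foot (parent x) = foot x
  adj_cases : ∀ x y, G.Adj x y → (height x ≠ 0 ∧ parent x = y) ∨ (height y ≠ 0 ∧ parent y = x) ∨
    ∃ i, (x = a i ∧ y = a (i + 1)) ∨ (y = a i ∧ x = a (i + 1))
  mem_tree : ∀ i x, x ∈ tree G a (a i) ↔ foot x = i

/-- In the forest the path from the foot to `x` is unique; its length is the height and its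
penultimate vertex the parent. Of two adjacent vertices, one has a path extending that of the other.
-/
theorem IsUnicyclic.nonempty_rooting {V : Type*} {G : SimpleGraph V} {ℓ : ℕ} {a : ZMod ℓ → V}
    (hG : IsUnicyclic G) (ha : IsCycleLabeling G a) : Nonempty (Rooting G a) := by
  choose foot hfoot using hG.exists_reachable a
  choose P hP using fun x => (hfoot x).exists_isPath
  have hac := hG.isAcyclic_deleteEdges ha
  have foot_eq : ∀ x i, (G.deleteEdges (cycleEdges a)).Reachable (a i) x → foot x = i :=
    fun x i h => hG.eq_of_reachable ha ((hfoot x).trans h.symm)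
  have foot_label : ∀ i, foot (a i) = i := fun i => foot_eq _ _ Reachable.rfl
  have adj_foot : ∀ x y, (G.deleteEdges (cycleEdges a)).Adj x y → foot x = foot y :=
    fun x y h => foot_eq _ _ ((hfoot y).trans h.symm.reachable)
  have hl0 : ∀ x, (P x).length = 0 → x = a (foot x) :=
    fun x h => (Walk.eq_of_length_eq_zero h).symm
  have main : ∀ x y, (G.deleteEdges (cycleEdges a)).Adj x y → x ∈ (P y).support →
      (P y).length = (P x).length + 1 ∧ (P y).penultimate = x := by
    intro x y h hx
    have hf := adj_foot x y h
    have := hac.path_concat (u := a (foot y)) (p := (P x).copy (by rw [hf]) rfl) (q := P y)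
      (by simpa using hP x) (hP y) h hx
    rw [this]
    simp
  have hnil : ∀ x, (P x).length ≠ 0 → ¬ (P x).Nil := by
    intro x h hn
    exact h (Walk.length_eq_zero_iff.mpr hn)
  have hpar : ∀ x, (P x).length ≠ 0 →
      (G.deleteEdges (cycleEdges a)).Adj (P x).penultimate x := by
    intro x h
    exact Walk.adj_penultimate (hnil x h)
  refine ⟨⟨fun x => (P x).length, fun x => (P x).penultimate, foot, ?_, foot_label, hl0, ?_, ?_, ?_,
    ?_, ?_⟩⟩
  · intro i
    have h2 : ((P (a i)).copy (by rw [foot_label]) rfl : (G.deleteEdges (cycleEdges a)).Walk (a i)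
        (a i)).IsPath := by rw [Walk.isPath_copy]; exact hP (a i)
    rw [Walk.isPath_iff_nil, ← Walk.length_eq_zero_iff, Walk.length_copy] at h2
    exact h2
  · intro x hx
    exact (deleteEdges_le _ (hpar x hx)).symm
  · intro x hx
    exact (main _ _ (hpar x hx) ((P x).getVert_mem_support _)).1
  · intro x hx
    exact adj_foot _ _ (hpar x hx)
  · intro x y h
    by_cases he : s(x, y) ∈ cycleEdges a
    · right; right
      obtain ⟨i, hi⟩ := he
      simp only [Sym2.eq_iff] at hi
      refine ⟨i, ?_⟩
      rcases hi with ⟨h1, h2⟩ | ⟨h1, h2⟩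
      · exact Or.inl ⟨h1.symm, h2.symm⟩
      · exact Or.inr ⟨h1.symm, h2.symm⟩
    · have hadj : (G.deleteEdges (cycleEdges a)).Adj x y := by
        rw [deleteEdges_adj]; exact ⟨h, he⟩
      by_cases hx : x ∈ (P y).support
      · right; left
        have := main x y hadj hx
        exact ⟨by omega, this.2⟩
      · left
        have hf := adj_foot x y hadj
        have hy : y ∈ (P x).support := by
          have := hac.mem_support_of_ne_mem_support_of_adj_of_isPath (u := a (foot x))
            (hP x) (q := (P y).copy (by rw [hf]) rfl) (by simpa using hP y) hadj (by simpa using hx)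
          exact this
        have := main y x hadj.symm hy
        exact ⟨by omega, this.2⟩
  · intro i x
    constructor
    · exact fun h => foot_eq _ _ h
    · rintro rfl
      exact hfoot x

/-- The distance between the positions `m` and `n` on a cycle of length `ℓ`. -/
def cyc (ℓ m n : ℕ) : ℕ := min (m - n + (n - m)) (ℓ - (m - n + (n - m)))

/-- A function growing by at most 1 along edges certifies a lower bound for distances. The exact
distance formulas below come from well-chosen potentials. -/
lemma sub_le_dist {V : Type*} {G : SimpleGraph V} (hG : G.Connected) (f : V → ℤ)
    (hf : ∀ x y, G.Adj x y → f y ≤ f x + 1) (x y : V) : f y - f x ≤ G.dist x y := by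
  obtain ⟨p, hp⟩ := hG.exists_walk_length_eq_dist x y
  rw [← hp]
  clear hp
  induction p with
  | nil => simp
  | cons h p ih =>
    have := hf _ _ h
    rw [Walk.length_cons]
    push_cast
    linarith

/-! ### Ancestors in the trees, and distances in terms of heights and positions -/

namespace Rooting

variable {V : Type*} {G : SimpleGraph V} {ℓ : ℕ} {a : ZMod ℓ → V} (R : Rooting G a)

/-- `R.Below c x`: the vertex `c` lies on the path from `x` to the cycle. -/
inductive Below (c : V) : V → Prop
  | refl : Below c c
  | step {x : V} (h : R.height x ≠ 0) (hx : Below c (R.parent x)) : Below c x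

/-- `c` is a child of `z`. -/
def IsChild (z c : V) : Prop := R.height c ≠ 0 ∧ R.parent c = z

/-- The index of the cycle vertex closest to `x`. -/
def idx (x : V) : ℕ := (R.foot x).val

lemma idx_lt [NeZero ℓ] (x : V) : R.idx x < ℓ := ZMod.val_lt _

lemma idx_label (n : ℕ) (hn : n < ℓ) : R.idx (a (n : ZMod ℓ)) = n := by
  rw [idx, R.foot_label, ZMod.val_cast_of_lt hn]

lemma label_idx [NeZero ℓ] (x : V) : a (R.idx x : ZMod ℓ) = a (R.foot x) := by
  simp [idx]

lemma idx_eq_iff [NeZero ℓ] {x y : V} : R.idx x = R.idx y ↔ R.foot x = R.foot y :=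
  (ZMod.val_injective ℓ).eq_iff

lemma mem_tree_natCast_iff [NeZero ℓ] {n : ℕ} (hn : n < ℓ) (x : V) :
    x ∈ tree G a (a (n : ZMod ℓ)) ↔ R.idx x = n := by
  rw [R.mem_tree]
  constructor
  · intro h
    rw [idx, h, ZMod.val_cast_of_lt hn]
  · rintro rfl
    simp [idx]

lemma mem_range_iff (x : V) : x ∈ Set.range a ↔ R.height x = 0 := by
  constructor
  · rintro ⟨i, rfl⟩
    exact R.height_label i
  · intro h
    exact ⟨_, (R.eq_of_height x h).symm⟩

variable {R}

namespace IsChild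

lemma height_eq {z c : V} (h : R.IsChild z c) : R.height c = R.height z + 1 := by
  rw [R.height_parent c h.1, h.2]

lemma adj {z c : V} (h : R.IsChild z c) : G.Adj z c := by
  have := R.adj_parent c h.1
  rw [h.2] at this
  exact this.symm

lemma below {z c : V} (h : R.IsChild z c) : R.Below z c :=
  Below.step h.1 (by rw [h.2]; exact Below.refl)

end IsChild

namespace Below

lemma height_le {c x : V} (h : R.Below c x) : R.height c ≤ R.height x := by
  induction h with
  | refl => rfl
  | @step x hx _ ih => have := R.height_parent x hx; omega

lemma foot_eq {c x : V} (h : R.Below c x) : R.foot x = R.foot c := by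
  induction h with
  | refl => rfl
  | @step x hx _ ih => rw [← ih, R.foot_parent x hx]

lemma idx_eq {c x : V} (h : R.Below c x) : R.idx x = R.idx c := by
  rw [idx, idx, h.foot_eq]

lemma trans {c d x : V} (h : R.Below c d) (h' : R.Below d x) : R.Below c x := by
  induction h' with
  | refl => exact h
  | step hx _ ih => exact step hx ih

lemma eq_of_height_eq {c x : V} (h : R.Below c x) (he : R.height c = R.height x) : c = x := by
  cases h with
  | refl => rfl
  | step hx h => have := h.height_le; have := R.height_parent x hx; omega

lemma parent_of_ne {c x : V} (h : R.Below c x) (hne : x ≠ c) :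
    R.height x ≠ 0 ∧ R.Below c (R.parent x) := by
  cases h with
  | refl => exact absurd rfl hne
  | step hx h => exact ⟨hx, h⟩

lemma eq_or_exists_child {c x : V} (h : R.Below c x) :
    x = c ∨ ∃ d, R.IsChild c d ∧ R.Below d x := by
  induction h with
  | refl => exact Or.inl rfl
  | @step x hx _ ih =>
    right
    rcases ih with h | ⟨d, hd, hdx⟩
    · exact ⟨x, ⟨hx, h⟩, refl⟩
    · exact ⟨d, hd, step hx hdx⟩

lemma of_le {c c' x : V} (h : R.Below c x) (h' : R.Below c' x)
    (hle : R.height c ≤ R.height c') : R.Below c c' := by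
  induction h' with
  | refl => exact h
  | @step x hx h' ih =>
    by_cases he : x = c
    · subst he
      have := h'.height_le
      have := R.height_parent x hx
      omega
    · exact ih (h.parent_of_ne he).2

lemma eq_of_isChild {z c c' x : V} (h : R.Below c x) (h' : R.Below c' x) (hc : R.IsChild z c)
    (hc' : R.IsChild z c') : c = c' := by
  have h1 := hc.height_eq
  have h2 := hc'.height_eq
  exact (h.of_le h' (by omega)).eq_of_height_eq (by omega)

lemma of_adj {c x y : V} (h : R.Below c x) (hy : ¬ R.Below c y) (hc : R.height c ≠ 0)
    (hadj : G.Adj x y) : x = c ∧ y = R.parent c := by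
  rcases R.adj_cases x y hadj with ⟨hx, rfl⟩ | ⟨hy', rfl⟩ | ⟨i, ⟨rfl, -⟩ | ⟨-, rfl⟩⟩
  · by_cases he : x = c
    · exact ⟨he, by rw [he]⟩
    · exact absurd (h.parent_of_ne he).2 hy
  · exact absurd (step hy' h) hy
  · have := h.height_le; rw [R.height_label] at this; omega
  · have := h.height_le; rw [R.height_label] at this; omega

end Below

variable (R)

lemma below_label (x : V) : R.Below (a (R.foot x)) x := by
  induction h : R.height x using Nat.strong_induction_on generalizing x with
  | _ n ih =>
    by_cases h0 : R.height x = 0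
    · have := R.eq_of_height x h0
      conv => arg 3; rw [this]
      exact Below.refl
    · apply Below.step h0
      rw [← R.foot_parent x h0]
      exact ih _ (by rw [← h, R.height_parent x h0]; omega) _ rfl

lemma exists_below_height (x : V) {n : ℕ} (hn : n ≤ R.height x) :
    ∃ c, R.Below c x ∧ R.height c = n := by
  induction h : R.height x using Nat.strong_induction_on generalizing x with
  | _ m ih =>
    by_cases h0 : R.height x = n
    · exact ⟨x, Below.refl, h0⟩
    · have hx : R.height x ≠ 0 := by omega
      have h1 := R.height_parent x hx
      obtain ⟨c, hc, hcn⟩ := ih (R.height (R.parent x)) (by omega) _ (by omega) rfl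
      exact ⟨c, Below.step hx hc, hcn⟩

/-- Two vertices of the same tree lie on a common path to the cycle, or these paths meet at a
vertex which they enter from two different children. -/
lemma below_or_meet (u u' : V) (hf : R.foot u = R.foot u') : R.Below u u' ∨ R.Below u' u ∨
    ∃ z c c', c ≠ c' ∧ R.IsChild z c ∧ R.IsChild z c' ∧ R.Below c u ∧ R.Below c' u' := by
  induction h : R.height u using Nat.strong_induction_on generalizing u with
  | _ n ih =>
    by_cases h0 : R.height u = 0
    · left
      have := R.below_label u'
      rwa [← hf, ← R.eq_of_height u h0] at this
    · have h1 := R.height_parent u h0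
      rcases ih _ (by omega) (R.parent u) (by rw [R.foot_parent u h0, hf]) rfl with
        h2 | h2 | ⟨z, c, c', hne, hc, hc', hcu, hcu'⟩
      · rcases h2.eq_or_exists_child with rfl | ⟨d, hd, hdu⟩
        · exact Or.inr (Or.inl (Below.step h0 Below.refl))
        · by_cases hdu' : d = u
          · subst hdu'; exact Or.inl hdu
          · exact Or.inr (Or.inr ⟨R.parent u, u, d, Ne.symm hdu', ⟨h0, rfl⟩, hd, Below.refl, hdu⟩)
      · exact Or.inr (Or.inl (Below.step h0 h2))
      · exact Or.inr (Or.inr ⟨z, c, c', hne, hc, hc', Below.step h0 hcu, hcu'⟩)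

lemma height_le_of_adj {x y : V} (h : G.Adj x y) : R.height y ≤ R.height x + 1 := by
  rcases R.adj_cases x y h with ⟨hx, rfl⟩ | ⟨hy', rfl⟩ | ⟨i, ⟨-, rfl⟩ | ⟨rfl, -⟩⟩
  · have := R.height_parent x hx; omega
  · have := R.height_parent y hy'; omega
  · rw [R.height_label]; omega
  · rw [R.height_label]; omega

variable {R}

lemma Below.dist_eq {c x : V} (h : R.Below c x) (hG : G.Connected) :
    G.dist c x = R.height x - R.height c := by
  have h1 := sub_le_dist hG (fun v => (R.height v : ℤ))
    (fun x y h => by have := R.height_le_of_adj h; omega) c x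
  have h2 : G.dist c x + R.height c ≤ R.height x := by
    clear h1
    induction h with
    | refl => simp
    | @step x hx _ ih =>
      have := R.height_parent x hx
      have h3 := hG.dist_triangle (u := c) (v := R.parent x) (w := x)
      have h4 := dist_eq_one_iff_adj.mpr (R.adj_parent x hx).symm
      omega
  beta_reduce at h1
  omega

lemma Below.dist_of_not_below {c s x : V} (hs : R.Below c s) (hx : ¬ R.Below c x)
    (hG : G.Connected) (hc : R.height c ≠ 0) :
    G.dist s x + R.height c = R.height s + 1 + G.dist (R.parent c) x := by
  classical
  have hle := hs.height_le
  -- The potential is the distance from `R.parent c`, with a negative sign below `c`; the only edge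
  -- leaving that set joins `c`, of value -1, to its parent, of value 0.
  have h1 := sub_le_dist hG (fun v => if R.Below c v then (R.height c : ℤ) - 1 - R.height v
      else (G.dist (R.parent c) v : ℤ)) (by
    intro y w hyw
    have hh := R.height_le_of_adj hyw.symm
    have hp := R.height_parent c hc
    by_cases hy : R.Below c y <;> by_cases hw : R.Below c w
    · simp only [if_pos hy, if_pos hw]; omega
    · simp only [if_pos hy, if_neg hw]
      obtain ⟨rfl, rfl⟩ := hy.of_adj hw hc hyw
      simp
    · simp only [if_neg hy, if_pos hw]
      have := hw.height_le
      omega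
    · simp only [if_neg hy, if_neg hw]
      have h3 := hG.dist_triangle (u := R.parent c) (v := y) (w := w)
      have h4 := dist_eq_one_iff_adj.mpr hyw
      omega) s x
  simp only [if_pos hs, if_neg hx] at h1
  have h2 := hs.dist_eq hG
  have h3 := hG.dist_triangle (u := s) (v := c) (w := x)
  have h4 := hG.dist_triangle (u := c) (v := R.parent c) (w := x)
  have h5 := dist_eq_one_iff_adj.mpr (R.adj_parent c hc)
  rw [dist_comm] at h2
  omega

/-- The distance of two vertices below different children of the same vertex. -/
lemma IsChild.dist_eq {z c c' u u' : V} (hc : R.IsChild z c) (hc' : R.IsChild z c') (hne : c ≠ c')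
    (hu : R.Below c u) (hu' : R.Below c' u') (hG : G.Connected) :
    G.dist u u' + 2 * R.height z = R.height u + R.height u' := by
  have h1 := hu.dist_of_not_below (x := u') (fun h => hne (h.eq_of_isChild hu' hc hc')) hG hc.1
  have h2 := hc.height_eq
  have h3 := (hc'.below.trans hu').dist_eq hG
  have h4 := (hc'.below.trans hu').height_le
  rw [hc.2] at h1
  omega

lemma Below.dist_le {c u u' : V} (hu : R.Below c u) (hu' : R.Below c u') (hG : G.Connected) :
    G.dist u u' + 2 * R.height c ≤ R.height u + R.height u' := by
  have h1 := hu.dist_eq hG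
  have h2 := hu'.dist_eq hG
  have := hu.height_le
  have := hu'.height_le
  have h3 := hG.dist_triangle (u := u) (v := c) (w := u')
  rw [dist_comm] at h1
  omega

variable (R)

lemma dist_label_add_le (hG : G.Connected) (hadj : ∀ i, G.Adj (a i) (a (i + 1))) (i : ZMod ℓ)
    (n : ℕ) : G.dist (a i) (a (i + n)) ≤ n := by
  induction n with
  | zero => simp
  | succ n ih =>
    have h3 := hG.dist_triangle (u := a i) (v := a (i + n)) (w := a (i + (n + 1 : ℕ)))
    have h4 := dist_eq_one_iff_adj.mpr (hadj (i + n))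
    rw [add_assoc] at h4
    push_cast at h3 ⊢
    omega

lemma idx_label_add_one [NeZero ℓ] (hl : 3 ≤ ℓ) (i : ZMod ℓ) :
    (R.idx (a i) + 1 < ℓ ∧ R.idx (a (i + 1)) = R.idx (a i) + 1) ∨
    (R.idx (a i) + 1 = ℓ ∧ R.idx (a (i + 1)) = 0) := by
  have : Fact (1 < ℓ) := ⟨by omega⟩
  have h1 : R.idx (a (i + 1)) = (R.idx (a i) + 1) % ℓ := by
    rw [idx, idx, R.foot_label, R.foot_label, ZMod.val_add, ZMod.val_one]
  have h2 := R.idx_lt (a i)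
  rcases Nat.lt_or_ge (R.idx (a i) + 1) ℓ with h | h
  · rw [Nat.mod_eq_of_lt h] at h1; exact Or.inl ⟨h, h1⟩
  · have h : R.idx (a i) + 1 = ℓ := by omega
    rw [h, Nat.mod_self] at h1; exact Or.inr ⟨h, h1⟩

lemma dist_label_le (ha : IsCycleLabeling G a) (hG : G.Connected) {m n : ℕ} (hm : m < ℓ)
    (hn : n < ℓ) : G.dist (a (m : ZMod ℓ)) (a (n : ZMod ℓ)) ≤ cyc ℓ m n := by
  have key : ∀ m n : ℕ, m ≤ n → n < ℓ → G.dist (a (m : ZMod ℓ)) (a (n : ZMod ℓ)) ≤ cyc ℓ m n := by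
    intro m n hmn hn
    have h1 := dist_label_add_le hG ha.adj (m : ZMod ℓ) (n - m)
    have h2 := dist_label_add_le hG ha.adj (n : ZMod ℓ) (ℓ - n + m)
    rw [← Nat.cast_add, show m + (n - m) = n by omega] at h1
    rw [← Nat.cast_add, show n + (ℓ - n + m) = ℓ + m by omega, dist_comm] at h2
    push_cast at h2
    rw [ZMod.natCast_self, zero_add] at h2
    unfold cyc
    omega
  rcases le_total m n with h | h
  · exact key m n h hn
  · rw [dist_comm]
    have := key n m h hm
    unfold cyc at *
    omega

lemma dist_label_foot (hG : G.Connected) (x : V) : G.dist (a (R.foot x)) x = R.height x := by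
  have := (R.below_label x).dist_eq hG
  rwa [R.height_label, Nat.sub_zero] at this

lemma dist_of_idx_ne (ha : IsCycleLabeling G a) (hG : G.Connected) {s x : V}
    (h : R.idx s ≠ R.idx x) :
    G.dist s x = R.height s + cyc ℓ (R.idx s) (R.idx x) + R.height x := by
  have := ha.neZero
  have hl := ha.three_le
  apply le_antisymm
  · have h1 := R.dist_label_foot hG s
    have h2 := R.dist_label_foot hG x
    have h3 := dist_label_le ha hG (R.idx_lt s) (R.idx_lt x)
    rw [R.label_idx, R.label_idx] at h3
    have h4 := hG.dist_triangle (u := s) (v := a (R.foot s)) (w := x)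
    have h5 := hG.dist_triangle (u := a (R.foot s)) (v := a (R.foot x)) (w := x)
    rw [dist_comm] at h1
    omega
  -- The potential is minus the height on the tree of `s`, and elsewhere the expected distance from
  -- the foot of `s`.
  · have h1 := sub_le_dist hG (fun v => if R.idx v = R.idx s then -(R.height v : ℤ)
      else (cyc ℓ (R.idx s) (R.idx v) + R.height v : ℤ)) (by
      intro y w hyw
      have hh := R.height_le_of_adj hyw
      have hh' := R.height_le_of_adj hyw.symm
      rcases R.adj_cases y w hyw with ⟨hx, hp⟩ | ⟨hx, hp⟩ | ⟨i, hi⟩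
      · have : R.idx w = R.idx y := by rw [idx, idx, ← hp, R.foot_parent y hx]
        simp only [this]
        split_ifs <;> omega
      · have : R.idx w = R.idx y := by rw [idx, idx, ← hp, R.foot_parent w hx]
        simp only [this]
        split_ifs <;> omega
      · have h1 := R.idx_label_add_one hl i
        have h2 := R.idx_lt (a i)
        have h3 := R.idx_lt (a (i + 1))
        have h4 := R.idx_lt s
        have h5 := R.height_label i
        have h6 := R.height_label (i + 1)
        rcases hi with ⟨rfl, rfl⟩ | ⟨rfl, rfl⟩
        all_goals
          simp only [h5, h6, cyc]
          split_ifs <;> omega) s x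
    simp only [if_neg h.symm, if_true] at h1
    omega

lemma dist_label (R : Rooting G a) (ha : IsCycleLabeling G a) (hG : G.Connected) {m n : ℕ}
    (hm : m < ℓ) (hn : n < ℓ) : G.dist (a (m : ZMod ℓ)) (a (n : ZMod ℓ)) = cyc ℓ m n := by
  by_cases h : m = n
  · subst h
    simp [cyc]
  · have := R.dist_of_idx_ne ha hG (s := a (m : ZMod ℓ)) (x := a (n : ZMod ℓ))
      (by rwa [R.idx_label m hm, R.idx_label n hn])
    rwa [R.idx_label m hm, R.idx_label n hn, R.height_label, R.height_label, Nat.zero_add,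
      Nat.add_zero] at this

/-- Vertices of the same tree are at distance at most the sum of their heights. -/
lemma dist_le_of_foot_eq (hG : G.Connected) {s x : V} (h : R.foot s = R.foot x) :
    G.dist s x ≤ R.height s + R.height x := by
  have h1 := R.below_label s
  rw [h] at h1
  have := h1.dist_le (R.below_label x) hG
  omega

end Rooting

/-! ### Arithmetic of positions on the cycle -/

lemma cyc_triple_cases {ℓ m₁ m₂ m₃ i : ℕ} (h12 : m₁ < m₂) (h23 : m₂ < m₃) (h3 : m₃ < ℓ)
    (hi : i < ℓ) (g12 : 2 * (m₂ - m₁) ≤ ℓ) (g23 : 2 * (m₃ - m₂) ≤ ℓ) (g31 : ℓ ≤ 2 * (m₃ - m₁)) :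
    (m₁ ≤ i ∧ i ≤ m₂ ∧ cyc ℓ m₁ i + m₁ = i ∧ cyc ℓ m₂ i + i = m₂ ∧
      cyc ℓ m₃ i + i ≤ m₃ ∧ cyc ℓ m₃ i + m₃ ≤ ℓ + i ∧
      (cyc ℓ m₃ i + i = m₃ ∨ cyc ℓ m₃ i + m₃ = ℓ + i)) ∨
    (m₂ ≤ i ∧ i ≤ m₃ ∧ cyc ℓ m₂ i + m₂ = i ∧ cyc ℓ m₃ i + i = m₃ ∧
      cyc ℓ m₁ i + m₁ ≤ i ∧ cyc ℓ m₁ i + i ≤ ℓ + m₁ ∧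
      (cyc ℓ m₁ i + m₁ = i ∨ cyc ℓ m₁ i + i = ℓ + m₁)) ∨
    (m₃ ≤ i ∧ i < ℓ ∧ cyc ℓ m₃ i + m₃ = i ∧ cyc ℓ m₁ i + i = ℓ + m₁ ∧
      cyc ℓ m₂ i + m₂ ≤ i ∧ cyc ℓ m₂ i + i ≤ ℓ + m₂ ∧
      (cyc ℓ m₂ i + m₂ = i ∨ cyc ℓ m₂ i + i = ℓ + m₂)) ∨
    (0 ≤ i ∧ i ≤ m₁ ∧ cyc ℓ m₃ i + m₃ = ℓ + i ∧ cyc ℓ m₁ i + i = m₁ ∧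
      cyc ℓ m₂ i + i ≤ m₂ ∧ cyc ℓ m₂ i + m₂ ≤ ℓ + i ∧
      (cyc ℓ m₂ i + i = m₂ ∨ cyc ℓ m₂ i + m₂ = ℓ + i)) := by
  unfold cyc
  rcases le_total i m₁ with h | h
  · right; right; right; omega
  rcases le_total i m₂ with h' | h'
  · left; omega
  rcases le_total i m₃ with h'' | h''
  · right; left; omega
  · right; right; left; omega

/-- The three arcs have length at most `ℓ/2`. The distances from a position to the ends of its own
arc add up to the arc, and no position has a smaller sum; applied to both positions this gives `x =
y`. Equal distances to both ends of an arc determine the position, except for a mirror image when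
the arc is a half-cycle, and then the third vertex decides. -/
lemma eq_of_cyc_of_lt {ℓ m₁ m₂ m₃ i k x y : ℕ} (h12 : m₁ < m₂) (h23 : m₂ < m₃) (h3 : m₃ < ℓ)
    (hi : i < ℓ) (hk : k < ℓ) (h : cyc ℓ m₁ m₂ + cyc ℓ m₂ m₃ + cyc ℓ m₃ m₁ = ℓ)
    (e₁ : x + cyc ℓ m₁ i = y + cyc ℓ m₁ k) (e₂ : x + cyc ℓ m₂ i = y + cyc ℓ m₂ k)
    (e₃ : x + cyc ℓ m₃ i = y + cyc ℓ m₃ k) : i = k := by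
  have g : 2 * (m₂ - m₁) ≤ ℓ ∧ 2 * (m₃ - m₂) ≤ ℓ ∧ ℓ ≤ 2 * (m₃ - m₁) := by
    unfold cyc at h
    omega
  obtain ⟨g12, g23, g31⟩ := g
  -- The gap bounds without truncated subtraction; afterwards the cyclic distances become variables
  -- and all cases are linear.
  have g12' : 2 * m₂ ≤ ℓ + 2 * m₁ := by omega
  have g23' : 2 * m₃ ≤ ℓ + 2 * m₂ := by omega
  have g31' : ℓ + 2 * m₁ ≤ 2 * m₃ := by omega
  clear h
  have ci := cyc_triple_cases h12 h23 h3 hi g12 g23 g31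
  have ck := cyc_triple_cases h12 h23 h3 hk g12 g23 g31
  clear g12 g23 g31
  generalize cyc ℓ m₁ i = p₁ at *
  generalize cyc ℓ m₂ i = p₂ at *
  generalize cyc ℓ m₃ i = p₃ at *
  generalize cyc ℓ m₁ k = q₁ at *
  generalize cyc ℓ m₂ k = q₂ at *
  generalize cyc ℓ m₃ k = q₃ at *
  rcases ci with ci | ci | ci | ci <;> rcases ck with ck | ck | ck | ck
  all_goals
    obtain ⟨_, _, _, _, _, _, ci | ci⟩ := ci <;> obtain ⟨_, _, _, _, _, _, ck | ck⟩ := ck <;>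
      omega

lemma cyc_comm (ℓ m n : ℕ) : cyc ℓ m n = cyc ℓ n m := by
  unfold cyc
  omega

/-- The positions of a geodesic triple distinguish all positions on the cycle. -/
lemma eq_of_cyc {ℓ m₁ m₂ m₃ i k x y : ℕ} (h12 : m₁ ≠ m₂) (h23 : m₂ ≠ m₃) (h31 : m₃ ≠ m₁)
    (h1 : m₁ < ℓ) (h2 : m₂ < ℓ) (h3 : m₃ < ℓ)
    (hi : i < ℓ) (hk : k < ℓ) (h : cyc ℓ m₁ m₂ + cyc ℓ m₂ m₃ + cyc ℓ m₃ m₁ = ℓ)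
    (e₁ : x + cyc ℓ m₁ i = y + cyc ℓ m₁ k) (e₂ : x + cyc ℓ m₂ i = y + cyc ℓ m₂ k)
    (e₃ : x + cyc ℓ m₃ i = y + cyc ℓ m₃ k) : i = k := by
  have c12 := cyc_comm ℓ m₁ m₂
  have c23 := cyc_comm ℓ m₂ m₃
  have c31 := cyc_comm ℓ m₃ m₁
  rcases lt_or_gt_of_ne h12 with a | a <;> rcases lt_or_gt_of_ne h23 with b | b <;>
    rcases lt_or_gt_of_ne h31 with c | c
  · omega
  · exact eq_of_cyc_of_lt a b h3 hi hk h e₁ e₂ e₃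
  · exact eq_of_cyc_of_lt c a h2 hi hk (by omega) e₃ e₁ e₂
  · exact eq_of_cyc_of_lt c b h2 hi hk (by omega) e₁ e₃ e₂
  · exact eq_of_cyc_of_lt b c h1 hi hk (by omega) e₂ e₃ e₁
  · exact eq_of_cyc_of_lt a c h3 hi hk (by omega) e₂ e₁ e₃
  · exact eq_of_cyc_of_lt b a h1 hi hk (by omega) e₃ e₂ e₁
  · omega

/-- The points `0`, `j` and their antipodes cut the cycle into four arcs on which both distances are
linear. Their difference is constant (`j`, respectively `-j`) on the second and fourth arcs and
injective on the other two. Positions confused by `0` and `j` have equal differences, which leads to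
`cyc_cases`. -/
lemma cyc_pair_cases {ℓ j i : ℕ} (hj : 0 < j) (hj2 : 2 * j < ℓ) (hi : i < ℓ) :
    (i ≤ j ∧ cyc ℓ 0 i = i ∧ cyc ℓ j i + i = j) ∨
    (j < i ∧ 2 * i ≤ ℓ ∧ cyc ℓ 0 i = i ∧ cyc ℓ j i + j = i) ∨
    (ℓ < 2 * i ∧ 2 * i < ℓ + 2 * j ∧ cyc ℓ 0 i + i = ℓ ∧ cyc ℓ j i + j = i) ∨
    (ℓ + 2 * j ≤ 2 * i ∧ cyc ℓ 0 i + i = ℓ ∧ cyc ℓ j i + i = ℓ + j) := by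
  unfold cyc
  rcases le_or_gt i j with h | h
  · left; omega
  rcases le_or_gt (2 * i) ℓ with h' | h'
  · right; left; omega
  rcases lt_or_ge (2 * i) (ℓ + 2 * j) with h'' | h''
  · right; right; left; omega
  · right; right; right; omega

/-- The pairs of positions which `0` and `j` may fail to distinguish. -/
lemma cyc_cases {ℓ j i k x y : ℕ} (hj : 0 < j) (hj2 : 2 * j < ℓ) (hi : i < ℓ) (hk : k < ℓ)
    (hne : i ≠ k) (e₁ : x + cyc ℓ 0 i = y + cyc ℓ 0 k) (e₂ : x + cyc ℓ j i = y + cyc ℓ j k) :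
    (j ≤ i ∧ j ≤ k ∧ i ≤ ℓ / 2 ∧ k ≤ ℓ / 2) ∨
    ((i = 0 ∨ ℓ + 2 * j ≤ 2 * i) ∧ (k = 0 ∨ ℓ + 2 * j ≤ 2 * k)) ∨
    (2 * (ℓ / 2) = ℓ ∧ 0 < i ∧ i < j ∧ k = ℓ / 2 + j - i) ∨
    (2 * (ℓ / 2) = ℓ ∧ 0 < k ∧ k < j ∧ i = ℓ / 2 + j - k) := by
  rcases cyc_pair_cases hj hj2 hi with ci | ci | ci | ci <;>
    rcases cyc_pair_cases hj hj2 hk with ck | ck | ck | ck <;> omega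

/-! ### Degrees and children -/

namespace Rooting

variable {V : Type*} {G : SimpleGraph V} {ℓ : ℕ} {a : ZMod ℓ → V} (R : Rooting G a)

lemma adj_iff (ha : IsCycleLabeling G a) (x y : V) : G.Adj x y ↔ R.IsChild x y ∨
    (R.height x ≠ 0 ∧ y = R.parent x) ∨
    (R.height x = 0 ∧ (y = a (R.foot x + 1) ∨ y = a (R.foot x - 1))) := by
  constructor
  · intro h
    rcases R.adj_cases x y h with ⟨hx, hp⟩ | hc | ⟨i, ⟨rfl, rfl⟩ | ⟨rfl, rfl⟩⟩
    · exact Or.inr (Or.inl ⟨hx, hp.symm⟩)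
    · exact Or.inl hc
    · exact Or.inr (Or.inr ⟨R.height_label i, Or.inl (by rw [R.foot_label])⟩)
    · exact Or.inr (Or.inr ⟨R.height_label _, Or.inr (by rw [R.foot_label]; simp)⟩)
  · rintro (h | ⟨h, rfl⟩ | ⟨h, rfl | rfl⟩)
    · exact h.adj
    · exact R.adj_parent x h
    · rw [R.eq_of_height x h, R.foot_label]
      exact ha.adj _
    · have h1 := ha.adj (R.foot x - 1)
      rw [sub_add_cancel, ← R.eq_of_height x h] at h1
      exact h1.symm

section Degree

variable [Fintype V]

open Classical in
/-- The children of `z`. -/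
noncomputable def children (z : V) : Finset V := Finset.univ.filter (R.IsChild z)

variable {R}

lemma mem_children {z c : V} : c ∈ R.children z ↔ R.IsChild z c := by
  simp [children]

variable (R)

lemma degree_of_height_ne_zero [DecidableRel G.Adj] (ha : IsCycleLabeling G a) {x : V}
    (hx : R.height x ≠ 0) : G.degree x = (R.children x).card + 1 := by
  classical
  have : G.neighborFinset x = insert (R.parent x) (R.children x) := by
    ext y
    rw [mem_neighborFinset, R.adj_iff ha, Finset.mem_insert, mem_children]
    tauto
  rw [← card_neighborFinset_eq_degree, this, Finset.card_insert_of_notMem]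
  rw [mem_children]
  intro h
  have := h.height_eq
  have := R.height_parent x hx
  omega

lemma degree_of_height_eq_zero [DecidableRel G.Adj] (ha : IsCycleLabeling G a) {x : V}
    (hx : R.height x = 0) : G.degree x = (R.children x).card + 2 := by
  classical
  have : G.neighborFinset x = insert (a (R.foot x + 1)) (insert (a (R.foot x - 1))
      (R.children x)) := by
    ext y
    rw [mem_neighborFinset, R.adj_iff ha, Finset.mem_insert, Finset.mem_insert, mem_children]
    tauto
  rw [← card_neighborFinset_eq_degree, this, Finset.card_insert_of_notMem,
    Finset.card_insert_of_notMem]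
  · rw [mem_children]
    intro h
    exact h.1 (R.height_label _)
  · rw [Finset.mem_insert, mem_children]
    rintro (h | h)
    · have h1 := ha.injective h
      have h2 : ((2 : ℕ) : ZMod ℓ) = 0 := by
        push_cast
        linear_combination h1
      rw [ZMod.natCast_eq_zero_iff] at h2
      have := Nat.le_of_dvd (by norm_num) h2
      have := ha.three_le
      omega
    · exact h.1 (R.height_label _)

lemma three_le_degree_of_two_children [DecidableRel G.Adj] (ha : IsCycleLabeling G a)
    {z c c' : V} (hc : R.IsChild z c) (hc' : R.IsChild z c') (hne : c ≠ c') :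
    3 ≤ G.degree z := by
  have : 1 < (R.children z).card :=
    Finset.one_lt_card.mpr ⟨c, mem_children.mpr hc, c', mem_children.mpr hc', hne⟩
  by_cases h : R.height z = 0
  · rw [R.degree_of_height_eq_zero ha h]; omega
  · rw [R.degree_of_height_ne_zero ha h]; omega

/-- Two neighbors of a cycle vertex, and one of any other vertex, are not children; so both degree
bounds amount to having two children. -/
lemma isBranching_iff [DecidableRel G.Adj] (ha : IsCycleLabeling G a) (z : V) :
    IsBranching G a z ↔ ∃ c c', R.IsChild z c ∧ R.IsChild z c' ∧ c ≠ c' := by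
  have h1 : IsBranching G a z ↔ 1 < (R.children z).card := by
    rw [IsBranching, R.mem_range_iff]
    by_cases h : R.height z = 0
    · rw [R.degree_of_height_eq_zero ha h]; omega
    · rw [R.degree_of_height_ne_zero ha h]; omega
  rw [h1, Finset.one_lt_card]
  simp only [mem_children]
  constructor
  · rintro ⟨c, hc, c', hc', h⟩
    exact ⟨c, c', hc, hc', h⟩
  · rintro ⟨c, c', hc, hc', h⟩
    exact ⟨c, hc, c', hc', h⟩

lemma three_le_degree_of_isChild_label [DecidableRel G.Adj] (ha : IsCycleLabeling G a)
    {z c : V} (hz : R.height z = 0) (hc : R.IsChild z c) : 3 ≤ G.degree z := by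
  have : 0 < (R.children z).card := Finset.card_pos.mpr ⟨c, mem_children.mpr hc⟩
  rw [R.degree_of_height_eq_zero ha hz]; omega

lemma height_ne_zero_of_degree_eq_one [DecidableRel G.Adj] (ha : IsCycleLabeling G a) {x : V}
    (hx : G.degree x = 1) : R.height x ≠ 0 := by
  intro h
  rw [R.degree_of_height_eq_zero ha h] at hx
  omega

lemma not_isChild_of_degree_eq_one [DecidableRel G.Adj] (ha : IsCycleLabeling G a) {x : V}
    (hx : G.degree x = 1) (c : V) : ¬ R.IsChild x c := by
  intro h
  have h1 : 0 < (R.children x).card := Finset.card_pos.mpr ⟨c, mem_children.mpr h⟩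
  rw [R.degree_of_height_ne_zero ha (R.height_ne_zero_of_degree_eq_one ha hx)] at hx
  omega

lemma eq_of_isChild_of_degree_eq_two [DecidableRel G.Adj] (ha : IsCycleLabeling G a) {x c c' : V}
    (hx : G.degree x = 2) (hc : R.IsChild x c) (hc' : R.IsChild x c') : c = c' := by
  by_contra h
  have := R.three_le_degree_of_two_children ha hc hc' h
  omega

end Degree

end Rooting

/-! ### Threads and branch-resolving sets -/

section Threads

variable {V : Type*} [Fintype V] {G : SimpleGraph V} [DecidableRel G.Adj]

variable (G) in
/-- A path whose vertices have degree `2`, except for the last one, which has degree `1`. -/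
def IsPendant (p : List V) : Prop :=
  p.Nodup ∧ p.IsChain G.Adj ∧ (∀ x ∈ p.dropLast, G.degree x = 2) ∧ ∃ x ∈ p.getLast?, G.degree x = 1

lemma isPendant_singleton {c : V} : IsPendant G [c] ↔ G.degree c = 1 := by
  simp [IsPendant]

lemma isPendant_cons_cons {c d : V} {r : List V} : IsPendant G (c :: d :: r) ↔
    c ∉ d :: r ∧ G.Adj c d ∧ G.degree c = 2 ∧ IsPendant G (d :: r) := by
  simp only [IsPendant, List.nodup_cons (a := c), List.isChain_cons_cons, List.dropLast_cons_cons,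
    List.getLast?_cons_cons, List.forall_mem_cons]
  tauto

lemma mem_threads_iff {v : V} {p : List V} :
    p ∈ threads G v ↔ ∃ c r, p = c :: r ∧ G.Adj v c ∧ IsPendant G (c :: r) := by
  cases p with
  | nil => simp [threads]
  | cons c r =>
    simp only [threads, Set.mem_ofPred_eq, List.isChain_cons_cons, IsPendant, List.cons.injEq]
    constructor
    · rintro ⟨h1, ⟨h2, h3⟩, h4, h5⟩
      exact ⟨c, r, ⟨rfl, rfl⟩, h2, h1, h3, h4, h5⟩
    · rintro ⟨_, _, ⟨rfl, rfl⟩, h2, h1, h3, h4, h5⟩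
      exact ⟨h1, ⟨h2, h3⟩, h4, h5⟩

lemma IsPendant.degree_le {p : List V} (hp : IsPendant G p) {x : V} (hx : x ∈ p) :
    G.degree x ≤ 2 := by
  induction p with
  | nil => simp at hx
  | cons c r ih =>
    cases r with
    | nil =>
      rw [isPendant_singleton] at hp
      rw [List.mem_singleton] at hx
      rw [hx]; omega
    | cons d r =>
      rw [isPendant_cons_cons] at hp
      rcases List.mem_cons.mp hx with rfl | hx
      · omega
      · exact ih hp.2.2.2 hx

lemma finite_threads (v : V) : (threads G v).Finite := by
  exact (List.finite_length_le V (Fintype.card V)).subset fun p hp => hp.1.length_le_card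

/-- At most one thread attached to a vertex avoids a branch-resolving set. -/
lemma IsBranchResolving.thread_unique {S : Finset V} (hS : IsBranchResolving G S) {v : V}
    (hv : 3 ≤ G.degree v) {p q : List V} (hp : p ∈ threads G v) (hq : q ∈ threads G v)
    (hpS : ∀ x ∈ p, x ∉ S) (hqS : ∀ x ∈ q, x ∉ S) : p = q := by
  by_contra hne
  have h1 := hS v hv
  have hsub : {p | p ∈ threads G v ∧ ∃ x ∈ p, x ∈ S} ⊆ threads G v \ {p, q} := by
    rintro r ⟨hr, x, hxr, hxS⟩
    refine ⟨hr, ?_⟩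
    rintro (rfl | rfl)
    · exact hpS x hxr hxS
    · exact hqS x hxr hxS
  have h2 := Set.ncard_le_ncard hsub ((finite_threads v).subset Set.sdiff_subset)
  have h3 : ({p, q} : Set (List V)) ⊆ threads G v := by
    rintro r (rfl | rfl)
    · exact hp
    · exact hq
  have h4 := Set.ncard_sdiff_add_ncard_of_subset h3 (finite_threads v)
  rw [Set.ncard_pair hne] at h4
  omega

namespace Rooting

variable {ℓ : ℕ} {a : ZMod ℓ → V} (R : Rooting G a)

/-- Going back from the leaf: a cycle vertex followed by an off-cycle vertex would have a child,
hence degree at least 3. -/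
lemma height_ne_zero_of_isPendant (ha : IsCycleLabeling G a) {p : List V} (hp : IsPendant G p) :
    ∀ x ∈ p, R.height x ≠ 0 := by
  induction p with
  | nil => simp
  | cons c r ih =>
    cases r with
    | nil =>
      rw [isPendant_singleton] at hp
      intro x hx
      rw [List.mem_singleton] at hx
      rw [hx]
      exact R.height_ne_zero_of_degree_eq_one ha hp
    | cons d r =>
      rw [isPendant_cons_cons] at hp
      have ih := ih hp.2.2.2
      intro x hx
      rcases List.mem_cons.mp hx with rfl | hx
      · intro h0
        have hd := ih d (by simp)
        have hc : R.IsChild x d := by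
          rcases (R.adj_iff ha _ _).mp hp.2.1 with h | h | ⟨-, rfl | rfl⟩
          · exact h
          · exact absurd h0 h.1
          · exact absurd (R.height_label _) hd
          · exact absurd (R.height_label _) hd
        have := R.three_le_degree_of_isChild_label ha h0 hc
        omega
      · exact ih x hx

/-- A pendant path does not lead towards the cycle. -/
lemma not_isPendant_of_isChild (ha : IsCycleLabeling G a) {c b : V} {r : List V}
    (hb : R.IsChild c b) (hbr : b ∉ r) : ¬ IsPendant G (c :: r) := by
  induction r generalizing c b with
  | nil =>
    rw [isPendant_singleton]
    exact fun h => R.not_isChild_of_degree_eq_one ha h b hb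
  | cons d r ih =>
    intro h
    have h0 := R.height_ne_zero_of_isPendant ha h c (by simp)
    rw [isPendant_cons_cons] at h
    obtain ⟨hcr, hadj, hdeg, hp⟩ := h
    rcases (R.adj_iff ha _ _).mp hadj with hd | ⟨-, rfl⟩ | ⟨h, -⟩
    · exact hbr (by rw [R.eq_of_isChild_of_degree_eq_two ha hdeg hb hd]; simp)
    -- The path climbs to the parent, where the child just left is again off the rest of the path;
    -- such a climb cannot end in a leaf.
    · exact ih ⟨h0, rfl⟩ (fun h => hcr (List.mem_cons_of_mem _ h)) hp
    · exact h0 h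

lemma isChild_of_mem_threads (ha : IsCycleLabeling G a) {v c : V} {r : List V}
    (hv : 3 ≤ G.degree v) (hp : c :: r ∈ threads G v) : R.IsChild v c := by
  obtain ⟨_, _, h, hadj, hp⟩ := mem_threads_iff.mp hp
  obtain ⟨rfl, rfl⟩ := List.cons.inj h
  have h0 := R.height_ne_zero_of_isPendant ha hp c (by simp)
  rcases (R.adj_iff ha _ _).mp hadj with hd | ⟨hv0, rfl⟩ | ⟨-, rfl | rfl⟩
  · exact hd
  · refine absurd hp (R.not_isPendant_of_isChild ha ⟨hv0, rfl⟩ ?_)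
    intro h
    have := hp.degree_le (List.mem_cons_of_mem _ h)
    omega
  · exact absurd (R.height_label _) h0
  · exact absurd (R.height_label _) h0

lemma isChild_of_isPendant_cons_cons (ha : IsCycleLabeling G a) {c d : V} {r : List V}
    (hp : IsPendant G (c :: d :: r)) (hr : R.parent c ∉ d :: r) : R.IsChild c d := by
  have h0 := R.height_ne_zero_of_isPendant ha hp c (by simp)
  rw [isPendant_cons_cons] at hp
  rcases (R.adj_iff ha _ _).mp hp.2.1 with hd | ⟨-, rfl⟩ | ⟨h, -⟩
  · exact hd
  · exact absurd (by simp) hr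
  · exact absurd h h0

/-- Once `hr` excludes turning back to the parent, each vertex of degree 2 leaves only its single
child to continue with. -/
lemma mem_iff_below_of_isPendant (ha : IsCycleLabeling G a) {c : V} {r : List V}
    (hp : IsPendant G (c :: r)) (hr : R.parent c ∉ r) (x : V) : x ∈ c :: r ↔ R.Below c x := by
  induction r generalizing c with
  | nil =>
    rw [isPendant_singleton] at hp
    rw [List.mem_singleton]
    constructor
    · rintro rfl; exact Below.refl
    · intro h
      rcases h.eq_or_exists_child with h | ⟨d, hd, -⟩
      · exact h
      · exact absurd hd (R.not_isChild_of_degree_eq_one ha hp d)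
  | cons d r ih =>
    have hd := R.isChild_of_isPendant_cons_cons ha hp hr
    rw [isPendant_cons_cons] at hp
    obtain ⟨hcr, hadj, hdeg, hp⟩ := hp
    rw [List.mem_cons, ih hp (by rw [hd.2]; exact fun h => hcr (List.mem_cons_of_mem _ h))]
    constructor
    · rintro (rfl | h)
      · exact Below.refl
      · exact hd.below.trans h
    · intro h
      rcases h.eq_or_exists_child with h | ⟨e, he, hx⟩
      · exact Or.inl h
      · rw [R.eq_of_isChild_of_degree_eq_two ha hdeg hd he]
        exact Or.inr hx

lemma isPendant_unique (ha : IsCycleLabeling G a) {c : V} {r r' : List V}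
    (hp : IsPendant G (c :: r)) (hr : R.parent c ∉ r) (hp' : IsPendant G (c :: r'))
    (hr' : R.parent c ∉ r') : r = r' := by
  induction r generalizing c r' with
  | nil =>
    cases r' with
    | nil => rfl
    | cons d' r' =>
      rw [isPendant_singleton] at hp
      rw [isPendant_cons_cons] at hp'
      omega
  | cons d r ih =>
    cases r' with
    | nil =>
      rw [isPendant_singleton] at hp'
      rw [isPendant_cons_cons] at hp
      omega
    | cons d' r' =>
      have hd := R.isChild_of_isPendant_cons_cons ha hp hr
      have hd' := R.isChild_of_isPendant_cons_cons ha hp' hr'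
      rw [isPendant_cons_cons] at hp hp'
      obtain rfl := R.eq_of_isChild_of_degree_eq_two ha hp.2.2.1 hd hd'
      rw [ih hp.2.2.2 (by rw [hd.2]; exact fun h => hp.1 (List.mem_cons_of_mem _ h)) hp'.2.2.2
        (by rw [hd.2]; exact fun h => hp'.1 (List.mem_cons_of_mem _ h))]

/-- A thread consists of the vertices below its first vertex. -/
lemma exists_of_mem_threads (ha : IsCycleLabeling G a) {v : V} {p : List V}
    (hv : 3 ≤ G.degree v) (hp : p ∈ threads G v) :
    ∃ c, c ∈ p ∧ R.IsChild v c ∧ ∀ x, x ∈ p ↔ R.Below c x := by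
  obtain ⟨c, r, rfl, hadj, hpen⟩ := mem_threads_iff.mp hp
  have hc := R.isChild_of_mem_threads ha hv hp
  refine ⟨c, by simp, hc, R.mem_iff_below_of_isPendant ha hpen ?_⟩
  rw [hc.2]
  intro h
  have := hpen.degree_le (List.mem_cons_of_mem _ h)
  omega

lemma thread_eq_of_mem (R : Rooting G a) (ha : IsCycleLabeling G a) {v : V} {p q : List V}
    (hv : 3 ≤ G.degree v) (hp : p ∈ threads G v) (hq : q ∈ threads G v) {x : V} (hxp : x ∈ p) (hxq : x ∈ q) :
    p = q := by
  obtain ⟨c, r, rfl, hadj, hpen⟩ := mem_threads_iff.mp hp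
  obtain ⟨c', r', rfl, hadj', hpen'⟩ := mem_threads_iff.mp hq
  have hc := R.isChild_of_mem_threads ha hv hp
  have hc' := R.isChild_of_mem_threads ha hv hq
  have h1 : v ∉ r := fun h => by
    have := hpen.degree_le (List.mem_cons_of_mem _ h)
    omega
  have h1' : v ∉ r' := fun h => by
    have := hpen'.degree_le (List.mem_cons_of_mem _ h)
    omega
  have h2 := (R.mem_iff_below_of_isPendant ha hpen (by rwa [hc.2]) x).mp hxp
  have h2' := (R.mem_iff_below_of_isPendant ha hpen' (by rwa [hc'.2]) x).mp hxq
  obtain rfl := h2.eq_of_isChild h2' hc hc'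
  rw [R.isPendant_unique ha hpen (by rwa [hc.2]) hpen' (by rwa [hc.2])]

/-- If one thread started strictly below the start of the other, its attachment vertex, of degree at
least 3, would lie on that other thread, where degrees are at most 2. -/
lemma eq_of_mem_threads (R : Rooting G a) (ha : IsCycleLabeling G a) {v v' : V} {p q : List V}
    (hv : 3 ≤ G.degree v) (hv' : 3 ≤ G.degree v') (hp : p ∈ threads G v) (hq : q ∈ threads G v')
    {x : V} (hxp : x ∈ p) (hxq : x ∈ q) : v = v' := by
  have key : ∀ {v v' : V} {p q : List V}, 3 ≤ G.degree v → 3 ≤ G.degree v' → p ∈ threads G v →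
      ∀ c c', R.IsChild v c → R.IsChild v' c' → (∀ x, x ∈ p ↔ R.Below c x) → R.Below c x →
      R.Below c' x → R.height c ≤ R.height c' → v = v' := by
    intro v v' p q hv hv' hp c c' hc hc' h h1 h2 hle
    have h3 := h1.of_le h2 hle
    by_cases he : c' = c
    · rw [← hc.2, ← hc'.2, he]
    · have h4 := (h3.parent_of_ne he).2
      rw [hc'.2, ← h] at h4
      obtain ⟨_, _, rfl, _, hpen⟩ := mem_threads_iff.mp hp
      have := hpen.degree_le h4
      omega
  obtain ⟨c, -, hc, hpc⟩ := R.exists_of_mem_threads ha hv hp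
  obtain ⟨c', -, hc', hqc⟩ := R.exists_of_mem_threads ha hv' hq
  have h1 := (hpc x).mp hxp
  have h2 := (hqc x).mp hxq
  rcases le_total (R.height c) (R.height c') with h | h
  · exact key (q := q) hv hv' hp c c' hc hc' hpc h1 h2 h
  · exact (key (q := q) hv' hv hq c' c hc' hc hqc h2 h1 h).symm

/-- If no vertex of a branch-resolving set lies below `c`, then the vertices below `c` contain a
pendant path starting at `c`. -/
lemma exists_isPendant (ha : IsCycleLabeling G a) {S : Finset V} (hS : IsBranchResolving G S)
    (c : V) (hc : R.height c ≠ 0) (hcS : ∀ s ∈ S, ¬ R.Below c s) :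
    ∃ r, IsPendant G (c :: r) ∧ ∀ x ∈ c :: r, R.Below c x := by
  -- Induction from the greatest height towards the cycle; a vertex with two children would carry
  -- two threads avoiding `S`.
  induction h : Finset.univ.sup R.height - R.height c using Nat.strong_induction_on
    generalizing c with
  | _ n ih =>
    have hle : ∀ x, R.height x ≤ Finset.univ.sup R.height := fun x => Finset.le_sup (by simp)
    have step : ∀ d, R.IsChild c d → ∃ r, IsPendant G (d :: r) ∧ ∀ x ∈ d :: r, R.Below d x := by
      intro d hd
      have h1 := hd.height_eq
      have h2 := hle d
      exact ih _ (by omega) d hd.1 (fun s hs hds => hcS s hs (hd.below.trans hds)) rfl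
    have hdeg := R.degree_of_height_ne_zero ha hc
    rcases Nat.lt_trichotomy (R.children c).card 1 with h1 | h1 | h1
    · refine ⟨[], isPendant_singleton.mpr (by omega), ?_⟩
      intro x hx
      rw [List.mem_singleton] at hx
      rw [hx]
      exact Below.refl
    · obtain ⟨d, hd⟩ := Finset.card_pos.mp (by omega : 0 < (R.children c).card)
      rw [mem_children] at hd
      obtain ⟨r, hr, hrd⟩ := step d hd
      refine ⟨d :: r, isPendant_cons_cons.mpr ⟨?_, hd.adj, by omega, hr⟩, ?_⟩
      · intro h
        have h1 := (hrd c h).height_le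
        have h2 := hd.height_eq
        omega
      · intro x hx
        rcases List.mem_cons.mp hx with rfl | hx
        · exact Below.refl
        · exact hd.below.trans (hrd x hx)
    · obtain ⟨d, hd, d', hd', hne⟩ := Finset.one_lt_card.mp h1
      rw [mem_children] at hd hd'
      obtain ⟨r, hr, hrd⟩ := step d hd
      obtain ⟨r', hr', hrd'⟩ := step d' hd'
      have := hS.thread_unique (v := c) (by omega)
        (mem_threads_iff.mpr ⟨d, r, rfl, hd.adj, hr⟩)
        (mem_threads_iff.mpr ⟨d', r', rfl, hd'.adj, hr'⟩)
        (fun x hx hxS => hcS x hxS (hd.below.trans (hrd x hx)))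
        (fun x hx hxS => hcS x hxS (hd'.below.trans (hrd' x hx)))
      exact absurd (List.cons.inj this).1 hne

/-- If no vertex of a branch-resolving set lies below the child `c` of `z`, then some thread
attached to `z` starts at `c` and avoids the set. -/
lemma exists_thread (ha : IsCycleLabeling G a) {S : Finset V} (hS : IsBranchResolving G S)
    {z c : V} (hc : R.IsChild z c) (hcS : ∀ s ∈ S, ¬ R.Below c s) :
    ∃ r, c :: r ∈ threads G z ∧ ∀ x ∈ c :: r, x ∉ S := by
  obtain ⟨r, hr, hrc⟩ := R.exists_isPendant ha hS c hc.1 hcS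
  exact ⟨r, mem_threads_iff.mpr ⟨c, r, rfl, hc.adj, hr⟩, fun x hx hxS => hcS x hxS (hrc x hx)⟩

/-- A branch-resolving set meets the vertices below one of any two children of a vertex. -/
lemma exists_below_of_two_children (ha : IsCycleLabeling G a) {S : Finset V}
    (hS : IsBranchResolving G S) {z c c' : V} (hc : R.IsChild z c) (hc' : R.IsChild z c')
    (hne : c ≠ c') : ∃ s ∈ S, R.Below c s ∨ R.Below c' s := by
  by_contra! h
  obtain ⟨r, hr, hrS⟩ := R.exists_thread ha hS hc fun s hs => (h s hs).1
  obtain ⟨r', hr', hrS'⟩ := R.exists_thread ha hS hc' fun s hs => (h s hs).2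
  have := hS.thread_unique (R.three_le_degree_of_two_children ha hc hc' hne) hr hr' hrS hrS'
  exact hne (List.cons.inj this).1

/-- Every vertex of a minimum branch-resolving set is needed at some branching vertex. -/
lemma exists_threads_of_mem (R : Rooting G a) (ha : IsCycleLabeling G a) {S : Finset V}
    (hS : IsMinLeafBranchResolving G S) {s : V} (hs : s ∈ S) :
    ∃ v, 3 ≤ G.degree v ∧ (∃ p ∈ threads G v, s ∈ p) ∧ ∃ q ∈ threads G v, ∀ x ∈ q, x ∉ S := by
  classical
  have h1 : ¬ IsBranchResolving G (S.erase s) := by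
    intro h
    have h2 := hS.2.1 _ h
    have h3 := Finset.card_erase_lt_of_mem hs
    omega
  simp only [IsBranchResolving, not_forall, not_le] at h1
  obtain ⟨v, hv, hlt⟩ := h1
  have hfin := finite_threads (G := G) v
  refine ⟨v, hv, ?_, ?_⟩
  -- If `s` lay on no thread at `v`, erasing it would not change the count at `v`.
  · by_contra! h
    have h2 := hS.1 v hv
    have h3 : {p | p ∈ threads G v ∧ ∃ x ∈ p, x ∈ S} ⊆
        {p | p ∈ threads G v ∧ ∃ x ∈ p, x ∈ S.erase s} := by
      rintro p ⟨hp, x, hx, hxS⟩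
      refine ⟨hp, x, hx, Finset.mem_erase.mpr ⟨?_, hxS⟩⟩
      rintro rfl
      exact h p hp hx
    have h4 := Set.ncard_le_ncard h3 (hfin.subset fun p hp => hp.1)
    omega
  -- If every thread met `S`, only threads through `s` could be lost by erasing it, and at most one
  -- thread at `v` contains `s`.
  · by_contra! h
    have hsp : ∀ p ∈ threads G v, p ∉ {p | p ∈ threads G v ∧ ∃ x ∈ p, x ∈ S.erase s} → s ∈ p := by
      intro p hp hn
      obtain ⟨x, hx, hxS⟩ := h p hp
      by_contra hsp
      exact hn ⟨hp, x, hx, Finset.mem_erase.mpr ⟨fun e => hsp (e ▸ hx), hxS⟩⟩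
    have h3 : {p | p ∈ threads G v ∧ ∃ x ∈ p, x ∈ S.erase s} ⊆ threads G v := fun p hp => hp.1
    have h4 := Set.ncard_sdiff_add_ncard_of_subset h3 hfin
    have h5 : (threads G v \ {p | p ∈ threads G v ∧ ∃ x ∈ p, x ∈ S.erase s}).ncard ≤ 1 := by
      rw [Set.ncard_le_one (hfin.subset Set.sdiff_subset)]
      rintro p ⟨hp, hpn⟩ q ⟨hq, hqn⟩
      exact R.thread_eq_of_mem ha hv hp hq (hsp p hp hpn) (hsp q hq hqn)
    omega

/-- Some thread attached to a bad vertex avoids a minimum branch-resolving set. -/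
lemma exists_isChild_of_isBad (ha : IsCycleLabeling G a) {S : Finset V}
    (hS : IsMinLeafBranchResolving G S) {v : V} (hv : IsBad G a v) :
    ∃ c, R.IsChild v c ∧ ∀ s ∈ S, ¬ R.Below c s := by
  obtain ⟨-, hdeg, p, hp⟩ := hv
  have key : ∃ q ∈ threads G v, ∀ x ∈ q, x ∉ S := by
    by_contra! h
    obtain ⟨s, hsp, hsS⟩ := h p hp
    obtain ⟨v', hv', ⟨p', hp', hsp'⟩, q, hq, hqS⟩ := R.exists_threads_of_mem ha hS hsS
    obtain rfl := R.eq_of_mem_threads ha (by omega) hv' hp hp' hsp hsp'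
    obtain ⟨x, hx, hxS⟩ := h q hq
    exact hqS x hx hxS
  obtain ⟨q, hq, hqS⟩ := key
  obtain ⟨c, -, hc, hqc⟩ := R.exists_of_mem_threads ha (by omega) hq
  exact ⟨c, hc, fun s hs hcs => hqS s ((hqc s).mpr hcs) hs⟩

end Rooting

end Threads

/-! ### Active positions; reflecting and rotating the labeling -/

namespace Rooting

variable {V : Type*} {G : SimpleGraph V} {ℓ : ℕ} {a : ZMod ℓ → V} (R : Rooting G a)

lemma mem_activeVertices_iff [NeZero ℓ] (S : Finset V) (v : V) :
    v ∈ activeVertices G a S ↔ R.height v = 0 ∧ ∃ s ∈ S, R.idx s = R.idx v := by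
  rw [activeVertices, Set.mem_ofPred_eq, R.mem_range_iff]
  refine and_congr_right fun h => exists_congr fun s => and_congr_right fun _ => ?_
  rw [R.eq_of_height v h, R.mem_tree, R.idx_eq_iff, R.foot_label]

lemma mem_activeIndices_iff [NeZero ℓ] (S : Finset V) (n : ℕ) :
    n ∈ activeIndices G a S ↔ ∃ s ∈ S, R.idx s = n := by
  rw [activeIndices, Set.mem_ofPred_eq, R.mem_activeVertices_iff, R.height_label]
  constructor
  · rintro ⟨hn, -, s, hs, h⟩
    exact ⟨s, hs, by rw [h, R.idx_label n hn]⟩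
  · rintro ⟨s, hs, rfl⟩
    exact ⟨R.idx_lt s, rfl, s, hs, by rw [R.idx_label _ (R.idx_lt s)]⟩

section Relabel

lemma cycleEdges_reflect (a : ZMod ℓ → V) (j : ZMod ℓ) :
    cycleEdges (fun i => a (j - i)) = cycleEdges a := by
  ext e
  constructor
  · rintro ⟨i, rfl⟩
    refine ⟨j - (i + 1), ?_⟩
    simp only [show j - (i + 1) + 1 = j - i by ring]
    exact Sym2.eq_swap
  · rintro ⟨i, rfl⟩
    refine ⟨j - (i + 1), ?_⟩
    simp only [show j - (j - (i + 1)) = i + 1 by ring, show j - (j - (i + 1) + 1) = i by ring]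
    exact Sym2.eq_swap

lemma cycleEdges_shift (a : ZMod ℓ → V) (q : ZMod ℓ) :
    cycleEdges (fun i => a (q + i)) = cycleEdges a := by
  ext e
  constructor
  · rintro ⟨i, rfl⟩
    refine ⟨q + i, ?_⟩
    simp only [add_assoc]
  · rintro ⟨i, rfl⟩
    refine ⟨i - q, ?_⟩
    simp only [show q + (i - q) = i by ring, show q + (i - q + 1) = i + 1 by ring]

lemma range_reflect (a : ZMod ℓ → V) (j : ZMod ℓ) :
    Set.range (fun i => a (j - i)) = Set.range a := by
  ext v
  constructor
  · rintro ⟨i, rfl⟩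
    exact ⟨_, rfl⟩
  · rintro ⟨i, rfl⟩
    exact ⟨j - i, by simp⟩

lemma isCycleLabeling_reflect (ha : IsCycleLabeling G a) (j : ZMod ℓ) :
    IsCycleLabeling G (fun i => a (j - i)) where
  three_le := ha.three_le
  injective := fun x y h => by simpa using ha.injective h
  adj := fun i => by
    have := (ha.adj (j - (i + 1))).symm
    rwa [show j - (i + 1) + 1 = j - i by ring] at this

lemma isCycleLabeling_shift (ha : IsCycleLabeling G a) (q : ZMod ℓ) :
    IsCycleLabeling G (fun i => a (q + i)) where
  three_le := ha.three_le
  injective := fun x y h => by simpa using ha.injective h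
  adj := fun i => by
    have := ha.adj (q + i)
    rwa [add_assoc] at this

/-- The rooting for the labeling read backwards from `j`. -/
def reflect (j : ZMod ℓ) : Rooting G (fun i => a (j - i)) where
  height := R.height
  parent := R.parent
  foot := fun x => j - R.foot x
  height_label := fun i => R.height_label _
  foot_label := fun i => by rw [R.foot_label]; ring
  eq_of_height := fun x h => by rw [sub_sub_cancel]; exact R.eq_of_height x h
  adj_parent := R.adj_parent
  height_parent := R.height_parent
  foot_parent := fun x h => by rw [R.foot_parent x h]
  adj_cases := fun x y h => by
    rcases R.adj_cases x y h with h | h | ⟨i, h⟩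
    · exact Or.inl h
    · exact Or.inr (Or.inl h)
    · refine Or.inr (Or.inr ⟨j - (i + 1), ?_⟩)
      rw [show j - (j - (i + 1)) = i + 1 by ring, show j - (j - (i + 1) + 1) = i by ring]
      tauto
  mem_tree := fun i x => by
    rw [tree, cycleEdges_reflect]
    rw [show (x ∈ {x | (G.deleteEdges (cycleEdges a)).Reachable (a (j - i)) x}) ↔
      R.foot x = j - i from R.mem_tree _ x]
    constructor
    · intro h; rw [h]; ring
    · rintro rfl; ring

/-- The rooting for the labeling starting at `q`. -/
def shift (q : ZMod ℓ) : Rooting G (fun i => a (q + i)) where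
  height := R.height
  parent := R.parent
  foot := fun x => R.foot x - q
  height_label := fun i => R.height_label _
  foot_label := fun i => by rw [R.foot_label]; ring
  eq_of_height := fun x h => by rw [add_sub_cancel]; exact R.eq_of_height x h
  adj_parent := R.adj_parent
  height_parent := R.height_parent
  foot_parent := fun x h => by rw [R.foot_parent x h]
  adj_cases := fun x y h => by
    rcases R.adj_cases x y h with h | h | ⟨i, h⟩
    · exact Or.inl h
    · exact Or.inr (Or.inl h)
    · refine Or.inr (Or.inr ⟨i - q, ?_⟩)
      rwa [show q + (i - q) = i by ring, show q + (i - q + 1) = i + 1 by ring]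
  mem_tree := fun i x => by
    rw [tree, cycleEdges_shift]
    rw [show (x ∈ {x | (G.deleteEdges (cycleEdges a)).Reachable (a (q + i)) x}) ↔
      R.foot x = q + i from R.mem_tree _ x]
    constructor
    · intro h; rw [h]; ring
    · rintro rfl; ring

lemma reflect_idx [NeZero ℓ] {j : ℕ} (hj : j < ℓ) (x : V) :
    (R.reflect (j : ZMod ℓ)).idx x =
      if R.idx x ≤ j then j - R.idx x else ℓ + j - R.idx x := by
  have hx := R.idx_lt x
  have h1 : ((R.reflect (j : ZMod ℓ)).foot x) =
      ((if R.idx x ≤ j then j - R.idx x else ℓ + j - R.idx x : ℕ) : ZMod ℓ) := by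
    have h2 : R.foot x = (R.idx x : ZMod ℓ) := by simp [idx]
    change (j : ZMod ℓ) - R.foot x = _
    rw [h2]
    split_ifs with h
    · rw [Nat.cast_sub h]
    · rw [Nat.cast_sub (by omega)]
      simp
  rw [idx, h1, ZMod.val_cast_of_lt]
  split_ifs <;> omega

lemma shift_idx [NeZero ℓ] {q : ℕ} (hq : q < ℓ) (x : V) :
    (R.shift (q : ZMod ℓ)).idx x =
      if q ≤ R.idx x then R.idx x - q else ℓ + R.idx x - q := by
  have hx := R.idx_lt x
  have h1 : ((R.shift (q : ZMod ℓ)).foot x) =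
      ((if q ≤ R.idx x then R.idx x - q else ℓ + R.idx x - q : ℕ) : ZMod ℓ) := by
    have h2 : R.foot x = (R.idx x : ZMod ℓ) := by simp [idx]
    change R.foot x - (q : ZMod ℓ) = _
    rw [h2]
    split_ifs with h
    · rw [Nat.cast_sub h]
    · rw [Nat.cast_sub (by omega)]
      simp
  rw [idx, h1, ZMod.val_cast_of_lt]
  split_ifs <;> omega

end Relabel

/-! ### Undistinguished pairs of vertices -/

section Distinguish

variable {S : Finset V}

/-- Only an `s` in the tree of `u` or `u'` needs an argument. If it is in that of `u`, then `dist s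
u` is at most the sum of the heights, so the height of `u` exceeds that of `u'` by at least their
cyclic distance. An element of `S` in another tree gives the reverse inequality, by the triangle
inequality on the cycle. -/
lemma height_add_cyc_eq (R : Rooting G a) (ha : IsCycleLabeling G a) (hG : G.Connected)
    (hact : ∀ i, ∃ s ∈ S, R.idx s ≠ i) {u u' : V} (hidx : R.idx u ≠ R.idx u')
    (h : ∀ s ∈ S, G.dist s u = G.dist s u') (s : V) (hs : s ∈ S) :
    R.height u + cyc ℓ (R.idx s) (R.idx u) = R.height u' + cyc ℓ (R.idx s) (R.idx u') := by
  have := ha.neZero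
  have key : ∀ {u u' : V}, R.idx u ≠ R.idx u' → (∀ s ∈ S, G.dist s u = G.dist s u') →
      R.idx s = R.idx u → R.height u = R.height u' + cyc ℓ (R.idx u) (R.idx u') := by
    intro u u' hidx h hsu
    have h1 := R.dist_le_of_foot_eq hG (R.idx_eq_iff.mp hsu)
    have h2 := R.dist_of_idx_ne ha hG (s := s) (x := u') (by rwa [hsu])
    have h3 := h s hs
    obtain ⟨t, ht, htu⟩ := hact (R.idx u)
    have h4 := R.dist_of_idx_ne ha hG htu
    have h5 := h t ht
    have i1 := R.idx_lt u
    have i2 := R.idx_lt u'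
    have i3 := R.idx_lt t
    rw [hsu] at h2
    by_cases htu' : R.idx t = R.idx u'
    · have h6 := R.dist_le_of_foot_eq hG (R.idx_eq_iff.mp htu')
      rw [htu'] at h4
      unfold cyc at *
      omega
    · have h6 := R.dist_of_idx_ne ha hG htu'
      unfold cyc at *
      omega
  have c0 : ∀ m, cyc ℓ m m = 0 := fun m => by simp [cyc]
  by_cases hsu : R.idx s = R.idx u
  · rw [hsu, c0, Nat.add_zero]
    exact key hidx h hsu
  · by_cases hsu' : R.idx s = R.idx u'
    · rw [hsu', c0, Nat.add_zero]
      exact (key hidx.symm (fun s hs => (h s hs).symm) hsu').symm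
    · have h1 := R.dist_of_idx_ne ha hG hsu
      have h2 := R.dist_of_idx_ne ha hG hsu'
      have h3 := h s hs
      omega

/-- Hence the paths from `s` and `u` to the cycle meet only on the cycle, so `s` is not below the
same child of the cycle vertex as `u`. -/
lemma dist_eq_of_idx_eq (R : Rooting G a) (ha : IsCycleLabeling G a) (hG : G.Connected)
    (hact : ∀ i, ∃ s ∈ S, R.idx s ≠ i) {u u' : V} (hidx : R.idx u ≠ R.idx u')
    (h : ∀ s ∈ S, G.dist s u = G.dist s u') {s : V} (hs : s ∈ S) (hsu : R.idx s = R.idx u) :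
    G.dist s u = R.height s + R.height u := by
  have h1 := R.height_add_cyc_eq ha hG hact hidx h s hs
  have h2 := R.dist_of_idx_ne ha hG (s := s) (x := u') (by rwa [hsu])
  have c0 : ∀ m, cyc ℓ m m = 0 := fun m => by simp [cyc]
  rw [hsu, c0] at h1
  rw [hsu] at h2
  rw [h s hs, h2]
  omega

/-- A vertex of height 1 at position `k` would be confused with `a_{k+1}`: as `k + 1 ≤ ℓ/2`, both
are reached from every `s ∈ S` by a shortest path through `a_k`. -/
lemma height_eq_zero_of_isMetricGenerator (R : Rooting G a) (ha : IsCycleLabeling G a)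
    (hG : G.Connected) (hgen : IsMetricGenerator G S) {j : ℕ}
    (hle : ∀ s ∈ S, R.idx s ≤ j) (x : V) (hjx : j < R.idx x) (hx : R.idx x ≤ (ℓ - 2) / 2) :
    R.height x = 0 := by
  by_contra hne
  have := ha.neZero
  have hl := ha.three_le
  obtain ⟨c, hcx, hc⟩ := R.exists_below_height x (n := 1) (by omega)
  have hci := hcx.idx_eq
  have hj1 := R.idx_label (R.idx c + 1) (by omega)
  have hh := R.height_label ((R.idx c + 1 : ℕ) : ZMod ℓ)
  obtain ⟨s, hs, hne⟩ := hgen c (a ((R.idx c + 1 : ℕ) : ZMod ℓ))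
    (fun e => by rw [← e] at hh; omega)
  apply hne
  have hsj := hle s hs
  rw [R.dist_of_idx_ne ha hG (s := s) (x := a ((R.idx c + 1 : ℕ) : ZMod ℓ)) (by omega), hj1, hh,
    R.dist_of_idx_ne ha hG (s := s) (x := c) (by omega)]
  unfold cyc
  omega

/-- The path from `x` to the cycle passes through every smaller height. -/
lemma height_lt_ncard_tree [Finite V] (R : Rooting G a) (ha : IsCycleLabeling G a) (x : V) :
    R.height x < (tree G a (a (R.idx x : ZMod ℓ))).ncard := by
  have := ha.neZero
  have h1 : Set.Iic (R.height x) ⊆ R.height '' tree G a (a (R.idx x : ZMod ℓ)) := by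
    intro n hn
    obtain ⟨c, hc, hcn⟩ := R.exists_below_height x hn
    exact ⟨c, (R.mem_tree_natCast_iff (R.idx_lt x) c).mpr hc.idx_eq.symm, hcn⟩
  have h2 := Set.ncard_le_ncard h1 (Set.toFinite _)
  have h3 := Set.ncard_image_le (f := R.height)
    (Set.toFinite (tree G a (a (R.idx x : ZMod ℓ))))
  have h4 : (Set.Iic (R.height x)).ncard = R.height x + 1 := by
    rw [← Finset.coe_Iic, Set.ncard_coe_finset, Nat.card_Iic]
  omega

variable [Fintype V] [DecidableRel G.Adj]

/-- Distinct vertices of the same tree are distinguished. -/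
lemma eq_of_idx_eq (R : Rooting G a) (ha : IsCycleLabeling G a) (hG : G.Connected)
    (hS : IsBranchResolving G S) (hact : ∀ i, ∃ s ∈ S, R.idx s ≠ i) {u u' : V}
    (hidx : R.idx u = R.idx u') (h : ∀ s ∈ S, G.dist s u = G.dist s u') : u = u' := by
  have := ha.neZero
  have hh : R.height u = R.height u' := by
    obtain ⟨s, hs, hsu⟩ := hact (R.idx u)
    have h1 := R.dist_of_idx_ne ha hG hsu
    have h2 := R.dist_of_idx_ne ha hG (hidx ▸ hsu)
    have h3 := h s hs
    rw [h1, h2, hidx] at h3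
    omega
  rcases R.below_or_meet u u' (R.idx_eq_iff.mp hidx) with hb | hb | ⟨z, c, c', hne, hc, hc', hu, hu'⟩
  · exact hb.eq_of_height_eq hh
  · exact (hb.eq_of_height_eq hh.symm).symm
  · exfalso
    obtain ⟨s, hs, hsc | hsc⟩ := R.exists_below_of_two_children ha hS hc hc' hne
    · have h1 := hsc.dist_le hu hG
      have h2 := hc.dist_eq hc' hne hsc hu' hG
      have h3 := h s hs
      have := hc.height_eq
      omega
    · have h1 := hsc.dist_le hu' hG
      have h2 := hc'.dist_eq hc hne.symm hsc hu hG
      have h3 := h s hs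
      have := hc'.height_eq
      omega

/-- Two vertices whose feet lie between `j` and the position antipodal to the first active
position are distinguished, provided that the trees between them are trivial and `a_j` is not
bad. -/
lemma not_of_between (R : Rooting G a) (ha : IsCycleLabeling G a) (hG : G.Connected)
    (hS : IsBranchResolving G S) (hleaf : ∀ s ∈ S, G.degree s = 1)
    (hact : ∀ i, ∃ s ∈ S, R.idx s ≠ i) {j : ℕ} (hjS : ∃ s ∈ S, R.idx s = j)
    (hbad : ¬ IsBad G a (a (j : ZMod ℓ)))
    (htriv : ∀ x, j < R.idx x → R.idx x ≤ (ℓ - 2) / 2 → R.height x = 0) {u u' : V}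
    (hju : j ≤ R.idx u) (huu' : R.idx u < R.idx u') (hu' : R.idx u' ≤ ℓ / 2)
    (h : ∀ s ∈ S, G.dist s u = G.dist s u') : False := by
  have := ha.neZero
  have hl := ha.three_le
  obtain ⟨s, hs, hsj⟩ := hjS
  have h1 := R.height_add_cyc_eq ha hG hact huu'.ne h s hs
  -- Seen from `j`, the vertex `u` has the nearer foot and must make up the difference by its
  -- height.
  have h2 : R.height u ≠ 0 := by
    rw [hsj] at h1
    unfold cyc at h1
    omega
  by_cases hj : j = R.idx u
  · have hlab : a (j : ZMod ℓ) = a (R.foot u) := by rw [hj, R.label_idx]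
    have hlab' : a (j : ZMod ℓ) = a (R.foot s) := by rw [← hsj, R.label_idx]
    rcases (R.below_label u).eq_or_exists_child with e | ⟨c, hc, hcu⟩
    · rw [e, R.height_label] at h2
      exact h2 rfl
    -- Having degree 1, `s` is not `a_j` itself, so it lies below some child of `a_j`; that child
    -- turns out to differ from `c`.
    rcases (R.below_label s).eq_or_exists_child with e | ⟨c', hc', hcs⟩
    · have := R.height_ne_zero_of_degree_eq_one ha (hleaf s hs)
      rw [e, R.height_label] at this
      exact this rfl
    have hcS : ∀ t ∈ S, ¬ R.Below c t := by
      intro t ht hct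
      have h3 := hct.dist_le hcu hG
      have h4 := R.dist_eq_of_idx_eq ha hG hact huu'.ne h ht (by rw [hct.idx_eq, hcu.idx_eq])
      have := hc.1
      omega
    obtain ⟨r, hr, -⟩ := R.exists_thread ha hS hc hcS
    rw [← hlab] at hc hr
    rw [← hlab'] at hc'
    have hb := (R.isBranching_iff ha _).mpr ⟨c, c', hc, hc', fun e => hcS s hs (e ▸ hcs)⟩
    rcases hb with hb | hb
    · exact hbad ⟨hb.1, hb.2, _, hr⟩
    · exact hb.1 ⟨_, rfl⟩
  · exact h2 (htriv u (by omega) (by omega))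

/-- The start `c` of an `S`-free thread at `a_j` is confused with `a_{j+1}`: both are adjacent to
`a_j` and, as `j + 1 ≤ ℓ/2`, are reached from `S` by shortest paths through it. -/
lemma not_isBad_of_isMetricGenerator (R : Rooting G a) (ha : IsCycleLabeling G a)
    (hG : G.Connected) (hS : IsMinLeafBranchResolving G S) (hgen : IsMetricGenerator G S) {j : ℕ}
    (hle : ∀ s ∈ S, R.idx s ≤ j) (hj : j < ℓ / 2) : ¬ IsBad G a (a (j : ZMod ℓ)) := by
  intro hbad
  have := ha.neZero
  have hl := ha.three_le
  obtain ⟨c, hc, hcS⟩ := R.exists_isChild_of_isBad ha hS hbad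
  have hcj : R.idx c = j := by rw [hc.below.idx_eq, R.idx_label j (by omega)]
  have hj1 := R.idx_label (j + 1) (by omega)
  have hh := R.height_label ((j + 1 : ℕ) : ZMod ℓ)
  have hhc := hc.height_eq
  have hhj := R.height_label (j : ZMod ℓ)
  obtain ⟨s, hs, hne⟩ := hgen c (a ((j + 1 : ℕ) : ZMod ℓ))
    (fun e => by rw [← e] at hj1; omega)
  apply hne
  have hsj := hle s hs
  rw [R.dist_of_idx_ne ha hG (s := s) (x := a ((j + 1 : ℕ) : ZMod ℓ)) (by omega), hj1, hh]
  by_cases he : R.idx s = j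
  · have h1 := Below.refl.dist_of_not_below (hcS s hs) hG hc.1
    have h2 : G.dist (R.parent c) s = R.height s := by
      rw [hc.2, ← he, R.label_idx, R.dist_label_foot hG]
    rw [he, dist_comm]
    unfold cyc
    omega
  · rw [R.dist_of_idx_ne ha hG (s := s) (x := c) (by omega), hcj]
    unfold cyc
    omega

/-- Together with `exists_branching_of_mem`: for a minimum branch-resolving set of leaves, active
trees are those with a branching vertex. This translates the premise of (iii). -/
lemma not_branching_of_not_active (R : Rooting G a) (ha : IsCycleLabeling G a)
    (hS : IsBranchResolving G S) {x : V} (hx : ∀ s ∈ S, R.idx s ≠ R.idx x) :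
    ¬ IsBranching G a x := by
  rw [R.isBranching_iff ha]
  rintro ⟨c, c', hc, hc', hne⟩
  obtain ⟨s, hs, h | h⟩ := R.exists_below_of_two_children ha hS hc hc' hne
  · exact hx s hs (by rw [h.idx_eq, hc.below.idx_eq])
  · exact hx s hs (by rw [h.idx_eq, hc'.below.idx_eq])

/-- The tree of an element of a minimum branch-resolving set contains a branching vertex. -/
lemma exists_branching_of_mem (R : Rooting G a) (ha : IsCycleLabeling G a)
    (hS : IsMinLeafBranchResolving G S) {s : V} (hs : s ∈ S) :
    ∃ x, R.idx x = R.idx s ∧ IsBranching G a x := by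
  obtain ⟨v, hv, ⟨p, hp, hsp⟩, q, hq, hqS⟩ := R.exists_threads_of_mem ha hS hs
  obtain ⟨c, -, hc, hpc⟩ := R.exists_of_mem_threads ha hv hp
  obtain ⟨c', -, hc', hqc⟩ := R.exists_of_mem_threads ha hv hq
  have hcs := (hpc s).mp hsp
  refine ⟨v, by rw [hcs.idx_eq, hc.below.idx_eq], (R.isBranching_iff ha v).mpr
    ⟨c, c', hc, hc', ?_⟩⟩
  rintro rfl
  exact hqS s ((hqc s).mpr hcs) hs

/-- Without branching vertices the height is injective on the tree. -/
lemma ncard_tree_le (R : Rooting G a) (ha : IsCycleLabeling G a) {t n : ℕ} (ht : t < ℓ)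
    (hbr : ∀ x, R.idx x = t → ¬ IsBranching G a x)
    (hn : ∀ x, R.idx x = t → R.height x < n) : (tree G a (a (t : ZMod ℓ))).ncard ≤ n := by
  have := ha.neZero
  have hinj : Set.InjOn R.height (tree G a (a (t : ZMod ℓ))) := by
    intro u hu u' hu' he
    rw [R.mem_tree_natCast_iff ht] at hu hu'
    rcases R.below_or_meet u u' (R.idx_eq_iff.mp (hu.trans hu'.symm)) with hb | hb |
      ⟨z, c, c', hne, hc, hc', hcu, -⟩
    · exact hb.eq_of_height_eq he
    · exact (hb.eq_of_height_eq he.symm).symm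
    · refine absurd ((R.isBranching_iff ha z).mpr ⟨c, c', hc, hc', hne⟩) (hbr z ?_)
      rw [← hu, hcu.idx_eq, hc.below.idx_eq]
  rw [← hinj.ncard_image]
  have h1 : R.height '' tree G a (a (t : ZMod ℓ)) ⊆ Set.Iio n := by
    rintro _ ⟨x, hx, rfl⟩
    exact hn x ((R.mem_tree_natCast_iff ht x).mp hx)
  have h2 := Set.ncard_le_ncard h1 (Set.finite_Iio n)
  rwa [← Finset.coe_Iio, Set.ncard_coe_finset, Nat.card_Iio] at h2

end Distinguish

end Rooting

/-! ### Normal labelings; necessity and sufficiency of the conditions -/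

namespace Rooting

variable {V : Type*} {G : SimpleGraph V} {ℓ : ℕ} {a : ZMod ℓ → V} {S : Finset V}

lemma isGeodesicTriple_of_cyc (R : Rooting G a) (ha : IsCycleLabeling G a) (hG : G.Connected)
    {s₁ s₂ s₃ : V} (h₁ : s₁ ∈ S) (h₂ : s₂ ∈ S) (h₃ : s₃ ∈ S) (h12 : R.idx s₁ ≠ R.idx s₂)
    (h23 : R.idx s₂ ≠ R.idx s₃) (h31 : R.idx s₃ ≠ R.idx s₁)
    (h : cyc ℓ (R.idx s₁) (R.idx s₂) + cyc ℓ (R.idx s₂) (R.idx s₃) +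
      cyc ℓ (R.idx s₃) (R.idx s₁) = ℓ) :
    ∃ u ∈ activeVertices G a S, ∃ v ∈ activeVertices G a S, ∃ w ∈ activeVertices G a S,
      IsGeodesicTriple G a u v w := by
  have := ha.neZero
  have hact : ∀ s ∈ S, a (R.idx s : ZMod ℓ) ∈ activeVertices G a S := fun s hs =>
    (R.mem_activeVertices_iff S _).mpr
      ⟨R.height_label _, s, hs, by rw [R.idx_label _ (R.idx_lt s)]⟩
  have hne : ∀ {s t : V}, R.idx s ≠ R.idx t → a (R.idx s : ZMod ℓ) ≠ a (R.idx t : ZMod ℓ) :=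
    fun hst e => hst (ha.natCast_inj (R.idx_lt _) (R.idx_lt _) e)
  refine ⟨_, hact s₁ h₁, _, hact s₂ h₂, _, hact s₃ h₃, ⟨⟨_, rfl⟩, ⟨_, rfl⟩, ⟨_, rfl⟩⟩,
    ⟨hne h12, hne h23, hne h31⟩, ?_⟩
  rw [R.dist_label ha hG (R.idx_lt _) (R.idx_lt _), R.dist_label ha hG (R.idx_lt _) (R.idx_lt _),
    R.dist_label ha hG (R.idx_lt _) (R.idx_lt _), h]

/-- If there is no geodesic triple of active vertices, then the active vertices of a normal
labeling lie in the first half of the cycle. -/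
lemma two_mul_le_of_isNormalLabeling (R : Rooting G a) (hG : G.Connected)
    (hn : IsNormalLabeling G a S) {j : ℕ} (hj : IsGreatest (activeIndices G a S) j)
    (htri : ¬ ∃ u ∈ activeVertices G a S, ∃ v ∈ activeVertices G a S,
      ∃ w ∈ activeVertices G a S, IsGeodesicTriple G a u v w) : 2 * j ≤ ℓ := by
  classical
  obtain ⟨ha, h0, hmin⟩ := hn
  have := ha.neZero
  have hl := ha.three_le
  by_contra! hlt
  obtain ⟨-, s₀, hs₀, hs₀0⟩ := (R.mem_activeVertices_iff S _).mp h0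
  have hi0 : R.idx (a 0) = 0 := by simpa using R.idx_label 0 (by omega)
  rw [hi0] at hs₀0
  obtain ⟨sj, hsj, hsjj⟩ := (R.mem_activeIndices_iff S j).mp hj.1
  obtain ⟨p, hp, hpmax⟩ := (S.filter fun s => 2 * R.idx s ≤ ℓ).exists_max_image R.idx
    ⟨s₀, by simp [hs₀, hs₀0]⟩
  obtain ⟨q, hq, hqmin⟩ := (S.filter fun s => ℓ < 2 * R.idx s).exists_min_image R.idx
    ⟨sj, by simp [hsj, hsjj, hlt]⟩
  simp only [Finset.mem_filter] at hp hq hpmax hqmin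
  have hql := R.idx_lt q
  have hjl := R.idx_lt sj
  let R' := R.shift (R.idx q : ZMod ℓ)
  have hR' : ∀ x, R'.idx x = _ := R.shift_idx hql
  -- Here `p` is the last active position up to `ℓ/2` and `q` the first one after it. Restarting the
  -- labeling at `q` gives largest active index `ℓ + p - q`, so normality yields `q - p ≤ ℓ - j <
  -- ℓ/2`, and `0`, `p`, `q` form a geodesic triple.
  have key := hmin _ (isCycleLabeling_shift ha (R.idx q : ZMod ℓ)) ?_ j (ℓ + R.idx p - R.idx q) hj ?_
  · refine htri (R.isGeodesicTriple_of_cyc ha hG hs₀ hp.1 hq.1 ?_ ?_ ?_ ?_)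
    · omega
    · omega
    · omega
    · unfold cyc
      omega
  · rw [R'.mem_activeVertices_iff]
    refine ⟨R.height_label _, q, hq.1, ?_⟩
    have h1 := R'.idx_label 0 (by omega)
    simp only [Nat.cast_zero] at h1
    rw [h1, hR']
    simp
  · constructor
    · rw [R'.mem_activeIndices_iff]
      refine ⟨p, hp.1, ?_⟩
      rw [hR', if_neg (by omega)]
    · intro m hm
      rw [R'.mem_activeIndices_iff] at hm
      obtain ⟨s, hs, rfl⟩ := hm
      rw [hR']
      have h1 := R.idx_lt s
      have h2 := hpmax s
      have h3 := hqmin s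
      simp only [hs, true_and] at h2 h3
      split_ifs <;> omega

/-- Two antipodal active vertices do not suffice. -/
lemma exists_geodesicTriple_of_antipodal (R : Rooting G a) (ha : IsCycleLabeling G a)
    (hG : G.Connected) (hgen : IsMetricGenerator G S) {j : ℕ} (hj : 2 * j = ℓ)
    (hle : ∀ s ∈ S, R.idx s ≤ j) (h0S : ∃ s ∈ S, R.idx s = 0) (hjS : ∃ s ∈ S, R.idx s = j) :
    ∃ u ∈ activeVertices G a S, ∃ v ∈ activeVertices G a S,
      ∃ w ∈ activeVertices G a S, IsGeodesicTriple G a u v w := by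
  have hl := ha.three_le
  have h1 := R.idx_label 1 (by omega)
  have h2 := R.idx_label (ℓ - 1) (by omega)
  -- These two vertices are mirror images in the axis through `a_0` and `a_j`, so whatever
  -- distinguishes them has a third position.
  obtain ⟨s, hs, hne⟩ := hgen (a ((1 : ℕ) : ZMod ℓ)) (a ((ℓ - 1 : ℕ) : ZMod ℓ))
    (fun e => by rw [e] at h1; omega)
  obtain ⟨s₀, hs₀, e₀⟩ := h0S
  obtain ⟨sj, hsj, ej⟩ := hjS
  have hmid : R.idx s ≠ 0 ∧ R.idx s ≠ j := by
    by_contra hcon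
    apply hne
    have h3 : R.idx s = 0 ∨ R.idx s = j := by omega
    have h4 : R.idx s ≠ 1 := by omega
    have h5 : R.idx s ≠ ℓ - 1 := by omega
    rw [R.dist_of_idx_ne ha hG (by rwa [h1]), R.dist_of_idx_ne ha hG (by rwa [h2]), h1, h2,
      R.height_label, R.height_label]
    rcases h3 with h3 | h3 <;> rw [h3] <;> unfold cyc <;> omega
  have h3 := hle s hs
  refine R.isGeodesicTriple_of_cyc ha hG hs₀ hs hsj (by omega) (by omega) (by omega) ?_
  rw [e₀, ej]
  unfold cyc
  omega

/-- The trees which the second condition requires to be trivial. -/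
lemma condII_iff (R : Rooting G a) (ha : IsCycleLabeling G a) {j : ℕ} :
    CondII G a j ↔ (∀ x, j < R.idx x → R.idx x ≤ (ℓ - 2) / 2 → R.height x = 0) ∧
      (∀ x, ℓ + j - (ℓ - 2) / 2 ≤ R.idx x → R.height x = 0) := by
  have := ha.neZero
  have hl := ha.three_le
  have htree : ∀ k, k < ℓ → (tree G a (a (k : ZMod ℓ)) = {a (k : ZMod ℓ)} ↔
      ∀ x, R.idx x = k → R.height x = 0) := by
    intro k hk
    constructor
    · intro h x hx
      rw [← R.mem_tree_natCast_iff hk, h] at hx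
      rw [Set.mem_singleton_iff.mp hx, R.height_label]
    · intro h
      ext x
      rw [R.mem_tree_natCast_iff hk, Set.mem_singleton_iff]
      constructor
      · intro hx
        rw [R.eq_of_height x (h x hx), ← R.label_idx, hx]
      · rintro rfl
        exact R.idx_label k hk
  -- For `j ≥ (ℓ - 2) / 2` both index ranges are empty, so the guard of the condition can be
  -- dropped.
  constructor
  · intro h
    refine ⟨fun x h1 h2 => ?_, fun x h1 => ?_⟩
    · exact (htree _ (R.idx_lt x)).mp
        (h (by omega) _ (Or.inr ⟨by omega, by omega⟩)) x rfl
    · have := R.idx_lt x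
      exact (htree _ (R.idx_lt x)).mp
        (h (by omega) _ (Or.inl ⟨by omega, by omega⟩)) x rfl
  · rintro ⟨h1, h2⟩ hj k (⟨hk1, hk2⟩ | ⟨hk1, hk2⟩)
    · exact (htree k (by omega)).mpr fun x hx => h2 x (by omega)
    · exact (htree k (by omega)).mpr fun x hx => h1 x (by omega) (by omega)

lemma condII_of_isMetricGenerator (R : Rooting G a) (ha : IsCycleLabeling G a)
    (hG : G.Connected) (hgen : IsMetricGenerator G S) {j : ℕ}
    (hle : ∀ s ∈ S, R.idx s ≤ j) (hj : j < ℓ / 2) : CondII G a j := by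
  have := ha.neZero
  have hjl : j < ℓ := by omega
  rw [R.condII_iff ha]
  refine ⟨R.height_eq_zero_of_isMetricGenerator ha hG hgen hle, fun x hx => ?_⟩
  have h1 := R.idx_lt x
  -- Reading the labels backwards from `a_j` swaps `a_0` and `a_j` and turns the arc before `a_0`
  -- into the arc after `a_j`.
  exact (R.reflect (j : ZMod ℓ)).height_eq_zero_of_isMetricGenerator
    (isCycleLabeling_reflect ha _) hG hgen (j := j) (fun s hs => by
      rw [R.reflect_idx hjl, if_pos (hle s hs)]
      omega) x (by rw [R.reflect_idx hjl]; split_ifs <;> omega)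
      (by rw [R.reflect_idx hjl]; split_ifs <;> omega)

variable [Fintype V] [DecidableRel G.Adj]

/-- In an even cycle, vertices of the trees of antipodal arcs are distinguished if the third
condition holds. -/
lemma not_of_opposite (R : Rooting G a) (ha : IsCycleLabeling G a) (hG : G.Connected)
    (hS : IsBranchResolving G S) (hact : ∀ i, ∃ s ∈ S, R.idx s ≠ i) {j : ℕ} (hj : 2 * j < ℓ)
    (heven : 2 * (ℓ / 2) = ℓ) (hle : ∀ s ∈ S, R.idx s ≤ j) (h0S : ∃ s ∈ S, R.idx s = 0)
    (hc : CondIII G a j) {u u' : V} (hu0 : 0 < R.idx u) (huj : R.idx u < j)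
    (hu' : R.idx u' = ℓ / 2 + j - R.idx u)
    (h : ∀ s ∈ S, G.dist s u = G.dist s u') : False := by
  have := ha.neZero
  -- A position strictly between `0` and `j` would separate the pair, given the equation at `0`.
  have hmid : ∀ s ∈ S, R.idx s = 0 ∨ R.idx s = j := by
    intro s hs
    obtain ⟨s₀, hs₀, e₀⟩ := h0S
    have h1 := R.height_add_cyc_eq ha hG hact (by omega : R.idx u ≠ R.idx u') h s₀ hs₀
    have h2 := R.height_add_cyc_eq ha hG hact (by omega : R.idx u ≠ R.idx u') h s hs
    have h3 := hle s hs
    rw [e₀] at h1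
    rw [hu'] at h1 h2
    unfold cyc at *
    omega
  have hheight : R.height u = R.height u' + (ℓ / 2 - j) := by
    obtain ⟨s₀, hs₀, e₀⟩ := h0S
    have h1 := R.height_add_cyc_eq ha hG hact (by omega : R.idx u ≠ R.idx u') h s₀ hs₀
    rw [e₀, hu'] at h1
    unfold cyc at *
    omega
  -- The trees strictly between are therefore inactive and free of branching vertices, so (iii)
  -- bounds the height of `u` below `ℓ/2 - j`.
  have h1 := hc (by omega) (fun k hk x hx => ?_) (R.idx u) ⟨hu0, by omega⟩
  · have h2 := R.height_lt_ncard_tree ha u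
    omega
  · apply R.not_branching_of_not_active ha hS
    intro s hs
    rw [R.mem_tree_natCast_iff (by have := hk.2; omega)] at hx
    have := hk.1
    have := hk.2
    have := hmid s hs
    omega

lemma condIII_of_isMetricGenerator (R : Rooting G a) (ha : IsCycleLabeling G a)
    (hG : G.Connected) (hS : IsMinLeafBranchResolving G S) (hgen : IsMetricGenerator G S)
    {j : ℕ} (hj : 2 * j < ℓ) (heven : 2 * (ℓ / 2) = ℓ) (hle : ∀ s ∈ S, R.idx s ≤ j) :
    CondIII G a j := by
  have := ha.neZero
  intro hj1 hbr t ht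
  obtain ⟨ht1, htj⟩ := ht
  have hmid : ∀ s ∈ S, R.idx s = 0 ∨ R.idx s = j := by
    intro s hs
    by_contra hcon
    have h1 := hle s hs
    obtain ⟨x, hx, hxb⟩ := R.exists_branching_of_mem ha hS hs
    exact hbr (R.idx s) ⟨by omega, by omega⟩ x
      ((R.mem_tree_natCast_iff (R.idx_lt s) x).mpr hx) hxb
  have key : (tree G a (a (t : ZMod ℓ))).ncard ≤ ℓ / 2 - j := by
    refine R.ncard_tree_le ha (by omega) (fun x hx => hbr t ⟨ht1, htj⟩ x
      ((R.mem_tree_natCast_iff (by omega) x).mpr hx)) ?_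
    intro x hx
    by_contra! hge
    -- At position `t`, height `ℓ/2 - j` is the offset that equalizes the distances to `c` and to
    -- `a_{ℓ/2 + j - t}` from both `0` and `j`.
    obtain ⟨c, hcx, hc⟩ := R.exists_below_height x hge
    have hci := hcx.idx_eq
    have hk := R.idx_label (ℓ / 2 + j - t) (by omega)
    have hh := R.height_label ((ℓ / 2 + j - t : ℕ) : ZMod ℓ)
    obtain ⟨s, hs, hne⟩ := hgen c (a ((ℓ / 2 + j - t : ℕ) : ZMod ℓ))
      (fun e => by rw [← e] at hk; omega)
    apply hne
    have h1 := hmid s hs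
    rw [R.dist_of_idx_ne ha hG (s := s) (x := c) (by omega),
      R.dist_of_idx_ne ha hG (s := s) (x := a ((ℓ / 2 + j - t : ℕ) : ZMod ℓ)) (by omega),
      hk, hh, hc, ← hci, hx]
    rcases h1 with h1 | h1 <;> rw [h1] <;> unfold cyc <;> omega
  omega

lemma isBad_reflect (j : ZMod ℓ) (v : V) :
    IsBad G (fun i => a (j - i)) v ↔ IsBad G a v := by
  rw [IsBad, IsBad, range_reflect]

lemma condI_of_isMetricGenerator (R : Rooting G a) (ha : IsCycleLabeling G a)
    (hG : G.Connected) (hS : IsMinLeafBranchResolving G S) (hgen : IsMetricGenerator G S) {j : ℕ}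
    (hle : ∀ s ∈ S, R.idx s ≤ j) (hj : j < ℓ / 2) : CondI G a j := by
  have := ha.neZero
  have hjl : j < ℓ := by omega
  refine ⟨?_, R.not_isBad_of_isMetricGenerator ha hG hS hgen hle hj⟩
  have h1 := (R.reflect (j : ZMod ℓ)).not_isBad_of_isMetricGenerator
    (isCycleLabeling_reflect ha _) hG hS hgen (j := j) (fun s hs => by
      rw [R.reflect_idx hjl, if_pos (hle s hs)]
      omega) hj
  rwa [isBad_reflect, sub_self] at h1

/-- Each case of `cyc_cases` is excluded by the conditions; the arc ending at `0` is handled in the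
reflected labeling. When `2j + 1 = ℓ` both outer arcs are single positions, so (i) and (ii) are not
needed. -/
lemma isMetricGenerator_of_conditions (R : Rooting G a) (ha : IsCycleLabeling G a)
    (hG : G.Connected) (hS : IsMinLeafBranchResolving G S)
    (hact : ∀ i, ∃ s ∈ S, R.idx s ≠ i) {j : ℕ} (hj0 : 0 < j) (hj : 2 * j < ℓ)
    (hle : ∀ s ∈ S, R.idx s ≤ j) (h0S : ∃ s ∈ S, R.idx s = 0) (hjS : ∃ s ∈ S, R.idx s = j)
    (hc : 2 * j + 1 = ℓ ∨ (CondI G a j ∧ CondII G a j))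
    (hc3 : 2 * (ℓ / 2) = ℓ → CondIII G a j) : IsMetricGenerator G S := by
  have := ha.neZero
  have hjl : j < ℓ := by omega
  intro u u' hne
  by_contra! h
  have hidx : R.idx u ≠ R.idx u' := fun e => hne (R.eq_of_idx_eq ha hG hS.1 hact e h)
  have h' : ∀ s ∈ S, G.dist s u' = G.dist s u := fun s hs => (h s hs).symm
  obtain ⟨s₀, hs₀, e₀⟩ := h0S
  obtain ⟨sj, hsj, ej⟩ := hjS
  have h1 := R.height_add_cyc_eq ha hG hact hidx h s₀ hs₀
  have h2 := R.height_add_cyc_eq ha hG hact hidx h sj hsj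
  rw [e₀] at h1
  rw [ej] at h2
  have hul := R.idx_lt u
  have hul' := R.idx_lt u'
  rcases cyc_cases hj0 hj hul hul' hidx h1 h2 with hcase | hcase | hcase | hcase
  · have hj' : 2 * j + 1 ≠ ℓ := by omega
    obtain ⟨hI, hII⟩ := hc.resolve_left hj'
    have htriv := ((R.condII_iff ha).mp hII).1
    rcases lt_or_gt_of_ne hidx with hlt | hlt
    · exact R.not_of_between ha hG hS.1 hS.2.2 hact ⟨sj, hsj, ej⟩ hI.2 htriv hcase.1 hlt
        hcase.2.2.2 h
    · exact R.not_of_between ha hG hS.1 hS.2.2 hact ⟨sj, hsj, ej⟩ hI.2 htriv hcase.2.1 hlt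
        hcase.2.2.1 h'
  · have hj' : 2 * j + 1 ≠ ℓ := by omega
    obtain ⟨hI, hII⟩ := hc.resolve_left hj'
    have htriv := ((R.condII_iff ha).mp hII).2
    have hr := R.reflect_idx hjl
    have hact' : ∀ i, ∃ s ∈ S, (R.reflect (j : ZMod ℓ)).idx s ≠ i := by
      intro i
      by_cases hi : i = 0
      · exact ⟨s₀, hs₀, by rw [hr, e₀, if_pos (by omega)]; omega⟩
      · exact ⟨sj, hsj, by rw [hr, ej, if_pos le_rfl]; omega⟩
    have hbad : ¬ IsBad G (fun i => a ((j : ZMod ℓ) - i)) (a ((j : ZMod ℓ) - (j : ZMod ℓ))) := by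
      rw [isBad_reflect, sub_self]
      exact hI.1
    have key : ∀ {u u' : V}, (R.idx u = 0 ∨ ℓ + 2 * j ≤ 2 * R.idx u) →
        (R.idx u' = 0 ∨ ℓ + 2 * j ≤ 2 * R.idx u') →
        (R.reflect (j : ZMod ℓ)).idx u < (R.reflect (j : ZMod ℓ)).idx u' →
        (∀ s ∈ S, G.dist s u = G.dist s u') → False := by
      intro u u' hu hu' hlt h
      have hul := R.idx_lt u
      have hul' := R.idx_lt u'
      refine (R.reflect (j : ZMod ℓ)).not_of_between (isCycleLabeling_reflect ha _) hG hS.1 hS.2.2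
        hact' (j := j) ⟨s₀, hs₀, ?_⟩ hbad ?_ ?_ hlt ?_ h
      · rw [hr, e₀, if_pos (by omega)]; omega
      · intro x hx1 hx2
        have := R.idx_lt x
        apply htriv x
        rw [hr] at hx1 hx2
        split_ifs at hx1 hx2 <;> omega
      · rw [hr]
        split_ifs <;> omega
      · rw [hr]
        split_ifs <;> omega
    have hne' : (R.reflect (j : ZMod ℓ)).idx u ≠ (R.reflect (j : ZMod ℓ)).idx u' := by
      rw [hr, hr]
      split_ifs <;> omega
    rcases lt_or_gt_of_ne hne' with hlt | hlt
    · exact key hcase.1 hcase.2 hlt h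
    · exact key hcase.2 hcase.1 hlt h'
  · exact R.not_of_opposite ha hG hS.1 hact hj hcase.1 hle ⟨s₀, hs₀, e₀⟩ (hc3 hcase.1) hcase.2.1
      hcase.2.2.1 hcase.2.2.2 h
  · exact R.not_of_opposite ha hG hS.1 hact hj hcase.1 hle ⟨s₀, hs₀, e₀⟩ (hc3 hcase.1) hcase.2.1
      hcase.2.2.1 hcase.2.2.2 h'

lemma isMetricGenerator_of_isGeodesicTriple (R : Rooting G a) (ha : IsCycleLabeling G a)
    (hG : G.Connected) (hS : IsBranchResolving G S) (hact : ∀ i, ∃ s ∈ S, R.idx s ≠ i)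
    {v₁ v₂ v₃ : V}
    (h₁ : v₁ ∈ activeVertices G a S) (h₂ : v₂ ∈ activeVertices G a S)
    (h₃ : v₃ ∈ activeVertices G a S) (ht : IsGeodesicTriple G a v₁ v₂ v₃) :
    IsMetricGenerator G S := by
  have := ha.neZero
  intro u u' hne
  by_contra! h
  have hidx : R.idx u ≠ R.idx u' := fun e => hne (R.eq_of_idx_eq ha hG hS hact e h)
  obtain ⟨-, ⟨n12, n23, n31⟩, hd⟩ := ht
  obtain ⟨z₁, s₁, hs₁, e₁⟩ := (R.mem_activeVertices_iff S _).mp h₁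
  obtain ⟨z₂, s₂, hs₂, e₂⟩ := (R.mem_activeVertices_iff S _).mp h₂
  obtain ⟨z₃, s₃, hs₃, e₃⟩ := (R.mem_activeVertices_iff S _).mp h₃
  have hlab : ∀ {v : V}, R.height v = 0 → v = a (R.idx v : ZMod ℓ) := fun {v} hv => by
    rw [R.label_idx]
    exact R.eq_of_height v hv
  have hinj : ∀ {v w : V}, R.height v = 0 → R.height w = 0 → v ≠ w → R.idx v ≠ R.idx w :=
    fun hv hw hvw e => hvw (by rw [hlab hv, hlab hw, e])
  have hdist : ∀ {v w : V}, R.height v = 0 → R.height w = 0 → v ≠ w →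
      G.dist v w = cyc ℓ (R.idx v) (R.idx w) := fun hv hw hvw => by
    rw [R.dist_of_idx_ne ha hG (hinj hv hw hvw), hv, hw, Nat.zero_add, Nat.add_zero]
  rw [hdist z₁ z₂ n12, hdist z₂ z₃ n23, hdist z₃ z₁ n31] at hd
  have f₁ := R.height_add_cyc_eq ha hG hact hidx h s₁ hs₁
  have f₂ := R.height_add_cyc_eq ha hG hact hidx h s₂ hs₂
  have f₃ := R.height_add_cyc_eq ha hG hact hidx h s₃ hs₃
  rw [e₁] at f₁
  rw [e₂] at f₂
  rw [e₃] at f₃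
  exact hidx (eq_of_cyc (hinj z₁ z₂ n12) (hinj z₂ z₃ n23) (hinj z₃ z₁ n31) (R.idx_lt _)
    (R.idx_lt _) (R.idx_lt _) (R.idx_lt _) (R.idx_lt _) hd f₁ f₂ f₃)

end Rooting

end UnicyclicMetric

/-! ### The characterization -/

theorem theorem1 {V : Type*} [Fintype V] (G : SimpleGraph V) [DecidableRel G.Adj]
    (hG : UnicyclicMetric.IsUnicyclic G)
    (S : Finset V) (hS : UnicyclicMetric.IsMinLeafBranchResolving G S)
    {ℓ : ℕ} (a : ZMod ℓ → V) (ha : UnicyclicMetric.IsNormalLabeling G a S)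
    (hA : 2 ≤ (UnicyclicMetric.activeVertices G a S).ncard)
    (j : ℕ) (hj : IsGreatest (UnicyclicMetric.activeIndices G a S) j) :
    UnicyclicMetric.IsMetricGenerator G S ↔
      (∃ u ∈ UnicyclicMetric.activeVertices G a S, ∃ v ∈ UnicyclicMetric.activeVertices G a S,
        ∃ w ∈ UnicyclicMetric.activeVertices G a S, UnicyclicMetric.IsGeodesicTriple G a u v w) ∨
      (UnicyclicMetric.IsOddGraph G a j ∨ UnicyclicMetric.IsEvenGraph G a j) := by
  obtain ⟨R⟩ := hG.nonempty_rooting ha.1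
  have hc := hG.1
  have hlab := ha.1
  have := hlab.neZero
  have hl := hlab.three_le
  have hle : ∀ s ∈ S, R.idx s ≤ j := fun s hs =>
    hj.2 ((R.mem_activeIndices_iff S _).mpr ⟨s, hs, rfl⟩)
  have hjS : ∃ s ∈ S, R.idx s = j := (R.mem_activeIndices_iff S j).mp hj.1
  have h0S : ∃ s ∈ S, R.idx s = 0 := by
    obtain ⟨-, s, hs, e⟩ := (R.mem_activeVertices_iff S _).mp ha.2.1
    have hi0 : R.idx (a 0) = 0 := by simpa using R.idx_label 0 (by omega)
    exact ⟨s, hs, by rw [e, hi0]⟩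
  have hj0 : 0 < j := by
    by_contra hj0
    have hsub : UnicyclicMetric.activeVertices G a S ⊆ {a 0} := by
      intro v hv
      obtain ⟨hv0, s, hs, e⟩ := (R.mem_activeVertices_iff S _).mp hv
      have h1 := hle s hs
      have h2 : R.idx v = 0 := by omega
      have h3 := R.label_idx v
      rw [h2, ← R.eq_of_height v hv0, Nat.cast_zero] at h3
      exact h3.symm
    have h1 := Set.ncard_le_ncard hsub (Set.finite_singleton _)
    rw [Set.ncard_singleton] at h1
    omega
  have hact : ∀ i, ∃ s ∈ S, R.idx s ≠ i := by
    intro i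
    obtain ⟨s₀, hs₀, e₀⟩ := h0S
    obtain ⟨sj, hsj, ej⟩ := hjS
    by_cases hi : i = 0
    · exact ⟨sj, hsj, by omega⟩
    · exact ⟨s₀, hs₀, by omega⟩
  constructor
  · intro hgen
    by_cases htri : ∃ u ∈ UnicyclicMetric.activeVertices G a S,
        ∃ v ∈ UnicyclicMetric.activeVertices G a S,
        ∃ w ∈ UnicyclicMetric.activeVertices G a S, UnicyclicMetric.IsGeodesicTriple G a u v w
    · exact Or.inl htri
    · right
      have h1 := R.two_mul_le_of_isNormalLabeling hc ha hj htri
      have h2 : 2 * j ≠ ℓ := fun e =>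
        htri (R.exists_geodesicTriple_of_antipodal hlab hc hgen e hle h0S hjS)
      -- The alternative `2j + 1 = ℓ` is the exceptional odd case, where `a_{j+1}` lies beyond the
      -- antipode of `a_0` and (i), (ii) need not hold.
      have h3 : j < ℓ / 2 ∨ 2 * j + 1 = ℓ := by omega
      rcases Nat.even_or_odd ℓ with he | ho
      · right
        have he' := Nat.two_mul_div_two_of_even he
        have h4 : j < ℓ / 2 := by omega
        exact ⟨he, ⟨hj0, by omega⟩, R.condI_of_isMetricGenerator hlab hc hS hgen hle h4,
          R.condII_of_isMetricGenerator hlab hc hgen hle h4,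
          R.condIII_of_isMetricGenerator hlab hc hS hgen (by omega) he' hle⟩
      · left
        refine ⟨ho, ⟨hj0, by omega⟩, ?_⟩
        rcases h3 with h4 | h4
        · exact Or.inr ⟨R.condI_of_isMetricGenerator hlab hc hS hgen hle h4,
            R.condII_of_isMetricGenerator hlab hc hgen hle h4⟩
        · exact Or.inl (by omega)
  · rintro (⟨u, hu, v, hv, w, hw, ht⟩ | ⟨ho, ⟨-, hj1⟩, hcond⟩ | ⟨he, ⟨-, hj1⟩, hI, hII, hIII⟩)
    · exact R.isMetricGenerator_of_isGeodesicTriple hlab hc hS.1 hact hu hv hw ht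
    · have ho' := Nat.two_mul_div_two_add_one_of_odd ho
      refine R.isMetricGenerator_of_conditions hlab hc hS hact hj0 (by omega) hle h0S hjS ?_
        (fun e => by omega)
      rcases hcond with h | h
      · exact Or.inl (by omega)
      · exact Or.inr h
    · exact R.isMetricGenerator_of_conditions hlab hc hS hact hj0 (by omega) hle h0S hjS
        (Or.inr ⟨hI, hII⟩) (fun _ => hIII)
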